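/- Let $q$ be a prime power, let $X$ be the Hermitian curve $y^q+y=x^{q+1}$ over $\mathbb{F}_{q^2}$, with function field $F=\mathbb{F}_{q^2}(X)$ and genus $g=q(q-1)/2$, let $P_\infty$ be its point at infinity (the common pole of $x$ and $y$) and $P_0$ the origin (the common zero of $x$ and $y$). For a divisor $G$ let $L(G)=\{0\}\cup\{f\in F\setminus\{0\} : (f)+G\ge 0\}$. For integers $a,b$ let $M_{P_\infty}(a,b)$ be the set of pairs $(f,g)$ in $F\times F$ with $$fg\in L(aP_\infty+bP_0)\setminus L((a-1)P_\infty+bP_0),\qquad f\in L(aP_\infty+bP_0),\qquad g\in L((a+b)P_\infty),$$ and let $M_{P_0}(a,b)$ be the set of pairs $(f,g)$ in $F\times F$ with $$fg\in L(aP_\infty+bP_0)\setminus L(aP_\infty+(b-1)P_0),\qquad f\in L(aP_\infty+bP_0),\qquad g\in L((a+b)P_0).$$ Put $$m_{P_\infty}(a,b)=\#\{-b\le i\le a+1 : \exists (f,g)\in M_{P_\infty}(a+1,b),\ \operatorname{ord}_{P_\infty}(f)=-i\},$$ $$m_{P_0}(a,b)=\#\{-a\le j\le b+1 : \exists (f,g)\in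 M_{P_0}(a,b+1),\ \operatorname{ord}_{P_0}(f)=-j\},$$ where $i,j$ run over integers. **Theorem.** Let $a=a_0(q+1)-a_1$ and $b=b_0(q+1)-b_1$ with integers $a_0,a_1,b_0,b_1$ such that $0\le a_1\le q$ and $0\le b_1\le q$, and let $d^*=a+b$ (the degree of $(2g-2+a)P_\infty+bP_0$ minus $2g-2$). 1. If $a_1<a_0+b_0$, then $m_{P_\infty}(2g-2+a,b)=d^*$. 2. If $a_0+b_0\le a_1\le a_0+b_0+q-1$, then $m_{P_\infty}(2g-2+a,b)=d^*+(a_1-a_0-b_0)(q+1-a_1)+\max\{0,b_1-a_1\}$. 3. If $a_0+b_0+q-1<a_1$, then $m_{P_\infty}(2g-2+a,b)=0$. 4. If $b_1<a_0+b_0$, then $m_{P_0}(2g-2+a,b)=d^*$. 5. If $a_0+b_0\le b_1\le a_0+b_0+q-1$, then $m_{P_0}(2g-2+a,b)=d^*+(b_1-a_0-b_0)(q+1-b_1)+\max\{0,a_1-b_1\}$. 6. If $a_0+b_0+q-1<b_1$, then $m_{P_0}(2g-2+a,b)=0$. -/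

import Mathlib

open Polynomial

noncomputable section

/-! ### Places, orders and Riemann-Roch spaces of a function field `F / k` -/

/-- A place (closed point of the smooth projective model) of `F / k`: a valuation ring of `F`
that contains the constants `k` and is different from `F`. -/
structure Place (k F : Type*) [Field k] [Field F] [Algebra k F] where
  /-- the valuation ring of the place -/
  ring : ValuationSubring F
  algebraMap_mem : ∀ c : k, algebraMap k F c ∈ ring
  ne_top : ring ≠ ⊤

namespace Place

variable {k F : Type*} [Field k] [Field F] [Algebra k F] (P : Place k F)

/-- `t` is a prime element (local parameter) at `P`: it generates the maximal ideal of the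
valuation ring of `P`. -/
def IsUniformizer (t : F) : Prop :=
  ∃ h : t ∈ P.ring, IsLocalRing.maximalIdeal P.ring = Ideal.span {⟨t, h⟩}

/-- `f` has order `n` at `P`: `f = u * t ^ n` for a unit `u` of the valuation ring and a prime
element `t`. For `f ≠ 0` in a function field there is exactly one such `n`. -/
def HasOrd (f : F) (n : ℤ) : Prop :=
  ∃ (u : P.ringˣ) (t : F), P.IsUniformizer t ∧ f = ((u : P.ring) : F) * t ^ n

theorem IsUniformizer.mem_nonunits {P : Place k F} {t : F} (h : P.IsUniformizer t) :
    t ∈ P.ring.nonunits := by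
  obtain ⟨h, he⟩ := h
  rw [ValuationSubring.mem_nonunits_iff_exists_mem_maximalIdeal]
  exact ⟨h, he ▸ Ideal.mem_span_singleton_self _⟩

theorem IsUniformizer.ne_zero {P : Place k F} {t : F} (h : P.IsUniformizer t) : t ≠ 0 := by
  rintro rfl
  obtain ⟨h, he⟩ := h
  apply P.ne_top
  have h0 : IsLocalRing.maximalIdeal P.ring = ⊥ := by
    rw [he, Ideal.span_singleton_eq_bot]
    rfl
  rw [eq_top_iff]
  intro x _
  by_contra hx
  have hx0 : x ≠ 0 := by
    rintro rfl
    exact hx P.ring.zero_mem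
  have h1 : x⁻¹ ∈ P.ring.nonunits := P.ring.inv_mem_nonunits_iff.2 (Or.inr hx)
  obtain ⟨h2, h3⟩ := P.ring.mem_nonunits_iff_exists_mem_maximalIdeal.1 h1
  rw [h0, Ideal.mem_bot] at h3
  exact inv_ne_zero hx0 (congrArg Subtype.val h3)

theorem HasOrd.unique {f : F} {m n : ℤ} (hm : P.HasOrd f m) (hn : P.HasOrd f n) : m = n := by
  obtain ⟨u, t, ht, rfl⟩ := hm
  obtain ⟨w, s, hs, h⟩ := hn
  have hv : ∀ u : P.ringˣ, P.ring.valuation ((u : P.ring) : F) = 1 := fun u =>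
    P.ring.valuation_unit u
  have hts : P.ring.valuation t = P.ring.valuation s := by
    obtain ⟨h1, e1⟩ := ht
    obtain ⟨h2, e2⟩ := hs
    rw [e1, Ideal.span_singleton_eq_span_singleton] at e2
    obtain ⟨v, hv'⟩ := e2
    have h3 := congrArg (fun z : P.ring => P.ring.valuation (z : F)) hv'
    simpa [hv] using h3
  have h4 := congrArg P.ring.valuation h
  rw [map_mul, map_mul, hv, hv, one_mul, one_mul, map_zpow₀, map_zpow₀, hts] at h4
  have h5 : P.ring.valuation s < 1 := hs.mem_nonunits
  have h6 : 0 < P.ring.valuation s := by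
    rw [zero_lt_iff]
    exact (Valuation.ne_zero_iff _).2 hs.ne_zero
  exact (zpow_right_strictAnti₀ h6 h5).injective h4

open Classical in
/-- The order of `f` at `P` (with the dummy value `0` for `f = 0`, where no such integer exists). -/
def ord (f : F) : ℤ :=
  if h : ∃ n : ℤ, P.HasOrd f n then h.choose else 0

end Place

/-- Divisors: formal integer combinations of places. -/
abbrev PlaceDivisor (k F : Type*) [Field k] [Field F] [Algebra k F] := Place k F →₀ ℤ

/-- The Riemann-Roch space `L(G)`: the zero function together with the nonzero `f` such that
`(f) + G ≥ 0`. -/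
def RRSpace {k F : Type*} [Field k] [Field F] [Algebra k F] (G : PlaceDivisor k F) : Set F :=
  {f | f = 0 ∨ ∀ P : Place k F, 0 ≤ P.ord f + G P}

/-! ### The Hermitian curve `y ^ q + y = x ^ (q + 1)` -/

namespace Hermitian

/-- The polynomial `x ^ (q + 1) - (y ^ q + y)`, in the variable `x` over `k[y]`. -/
def poly (k : Type*) [Field k] (q : ℕ) : k[X][X] :=
  X ^ (q + 1) - C (X ^ q + X)

/-- The affine coordinate ring `k[x, y] / (y ^ q + y - x ^ (q + 1))`. -/
abbrev CoordRing (k : Type*) [Field k] (q : ℕ) : Type _ := AdjoinRoot (poly k q)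

/-- The function field of the Hermitian curve. -/
abbrev FnField (k : Type*) [Field k] (q : ℕ) : Type _ := FractionRing (CoordRing k q)

/-- The coordinate function `x`. -/
def x (k : Type*) [Field k] (q : ℕ) : FnField k q :=
  algebraMap (CoordRing k q) (FnField k q) (AdjoinRoot.root (poly k q))

/-- The coordinate function `y`. -/
def y (k : Type*) [Field k] (q : ℕ) : FnField k q :=
  algebraMap (CoordRing k q) (FnField k q) (AdjoinRoot.of (poly k q) X)

section

variable (k : Type*) [Field k] (q : ℕ)

theorem curve_equation : y k q ^ q + y k q = x k q ^ (q + 1) := by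
  have h : AdjoinRoot.of (poly k q) X ^ q + AdjoinRoot.of (poly k q) X
      = AdjoinRoot.root (poly k q) ^ (q + 1) := by
    have h1 := AdjoinRoot.eval₂_root (poly k q)
    rw [poly, eval₂_sub, eval₂_X_pow, eval₂_C, sub_eq_zero] at h1
    rw [← map_pow, ← map_add]
    exact h1.symm
  have h2 := congrArg (algebraMap (CoordRing k q) (FnField k q)) h
  rwa [map_add, map_pow, map_pow] at h2

theorem poly_monic : (poly k q).Monic :=
  monic_X_pow_sub_C _ (Nat.succ_ne_zero q)

theorem poly_degree : (poly k q).degree = ((q + 1 : ℕ) : WithBot ℕ) :=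
  degree_X_pow_sub_C (Nat.succ_pos q) _

theorem y_transcendental : Transcendental k (y k q) := by
  have h1 : Function.Injective (algebraMap k[X] (CoordRing k q)) := by
    apply AdjoinRoot.of.injective_of_degree_ne_zero
    rw [poly_degree]
    exact_mod_cast Nat.succ_ne_zero q
  have h2 : Transcendental k (algebraMap k[X] (CoordRing k q) X) :=
    (transcendental_algebraMap_iff h1).2 (transcendental_X k)
  exact (transcendental_algebraMap_iff (IsFractionRing.injective _ (FnField k q))).2 h2

variable [hq : Fact (IsPrimePow q)]

theorem poly_irreducible : Irreducible (poly k q) := by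
  have hq1 : 1 < q := hq.out.one_lt
  have hP : (Ideal.span {(X : k[X])}).IsPrime :=
    (Ideal.span_singleton_prime X_ne_zero).2 prime_X
  refine irreducible_of_eisenstein_criterion hP ?_ ?_ ?_ ?_ (poly_monic k q).isPrimitive
  · rw [(poly_monic k q).leadingCoeff]
    exact fun h => hP.ne_top ((Ideal.eq_top_iff_one _).2 h)
  · intro n hn
    rw [poly_degree] at hn
    have hn' : n < q + 1 := by exact_mod_cast hn
    rw [poly, coeff_sub, coeff_X_pow, if_neg hn'.ne, zero_sub, neg_mem_iff, coeff_C]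
    split_ifs
    · rw [Ideal.mem_span_singleton]
      exact dvd_add (dvd_pow_self _ (by omega)) dvd_rfl
    · exact Ideal.zero_mem _
  · rw [poly_degree]
    exact_mod_cast Nat.succ_pos q
  · rw [poly, coeff_sub, coeff_X_pow, if_neg (Nat.succ_ne_zero q).symm, zero_sub, neg_mem_iff,
      coeff_C_zero, Ideal.span_singleton_pow, Ideal.mem_span_singleton, X_pow_dvd_iff]
    intro h
    have h1 := h 1 (by norm_num)
    rw [coeff_add, coeff_X_pow, if_neg (by omega), coeff_X_one, zero_add] at h1
    exact one_ne_zero h1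

instance : IsDomain (CoordRing k q) :=
  AdjoinRoot.isDomain_of_prime (poly_irreducible k q).prime

/-- There is a place at which both `x` and `y` have a pole. -/
theorem exists_place_infinity :
    ∃ P : Place k (FnField k q), x k q ∉ P.ring ∧ y k q ∉ P.ring := by
  have hq1 : 1 < q := hq.out.one_lt
  let A : Subring (FnField k q) := (integralClosure k (FnField k q)).toSubring
  have hA : IsIntegrallyClosedIn A (FnField k q) :=
    inferInstanceAs (IsIntegrallyClosedIn (integralClosure k (FnField k q)) (FnField k q))
  have hy : y k q ∉ A := fun h => y_transcendental k q h.isAlgebraic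
  obtain ⟨V, hAV, hV⟩ := Subring.exists_le_valuationSubring_of_isIntegrallyClosedIn hy
  refine ⟨⟨V, fun c => hAV (Subalgebra.algebraMap_mem _ c), ?_⟩, ?_, hV⟩
  · rintro rfl
    exact hV (ValuationSubring.mem_top _)
  · intro hx
    apply hV
    have hint : IsIntegral V (y k q) := by
      refine ⟨X ^ q + (X - C ⟨x k q ^ (q + 1), pow_mem hx _⟩), ?_, ?_⟩
      · refine monic_X_pow_add ?_
        rw [degree_X_sub_C]
        exact_mod_cast hq1
      · rw [eval₂_add, eval₂_X_pow, eval₂_sub, eval₂_X, eval₂_C, ← add_sub_assoc,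
          curve_equation]
        exact sub_self _
    obtain ⟨v, hv⟩ := IsIntegrallyClosed.isIntegral_iff.1 hint
    rw [← hv]
    exact v.2

/-- There is a place at which both `x` and `y` vanish. -/
theorem exists_place_origin :
    ∃ P : Place k (FnField k q), x k q ∈ P.ring.nonunits ∧ y k q ∈ P.ring.nonunits := by
  have hinj : Function.Injective (algebraMap (CoordRing k q) (FnField k q)) :=
    IsFractionRing.injective _ _
  let ev : CoordRing k q →+* k := AdjoinRoot.lift (evalRingHom 0) 0 (by
    have hq1 : 1 < q := hq.out.one_lt
    have hq0 : q ≠ 0 := by omega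
    rw [poly, eval₂_sub, eval₂_X_pow, eval₂_C]
    simp [hq0])
  have evx : ev (AdjoinRoot.root (poly k q)) = 0 := AdjoinRoot.lift_root _
  have evy : ev (AdjoinRoot.of (poly k q) X) = 0 := by
    rw [AdjoinRoot.lift_of]
    simp
  let e : CoordRing k q ≃+* (algebraMap (CoordRing k q) (FnField k q)).range :=
    RingEquiv.ofBijective (algebraMap (CoordRing k q) (FnField k q)).rangeRestrict
      ⟨fun _ _ h => hinj (congrArg Subtype.val h), RingHom.rangeRestrict_surjective _⟩
  let ev' := ev.comp e.symm.toRingHom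
  obtain ⟨V, hV, hm⟩ := Ideal.image_subset_nonunits_valuationSubring (RingHom.ker ev')
    (RingHom.ker_ne_top ev')
  have hmem : ∀ r : CoordRing k q, ev r = 0 →
      algebraMap (CoordRing k q) (FnField k q) r ∈ V.nonunits := by
    intro r hr
    refine hm ⟨e r, ?_, rfl⟩
    change ev (e.symm (e r)) = 0
    rwa [e.symm_apply_apply]
  refine ⟨⟨V, fun c => hV ⟨algebraMap k (CoordRing k q) c, ?_⟩, ?_⟩, hmem _ evx, hmem _ evy⟩
  · exact (IsScalarTower.algebraMap_apply k (CoordRing k q) (FnField k q) c).symm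
  · rintro rfl
    rcases (ValuationSubring.mem_nonunits_iff_or _).1 (hmem _ evy) with h | h
    · refine y_transcendental k q ?_
      rw [y, h]
      exact isAlgebraic_zero
    · exact h (ValuationSubring.mem_top _)

/-- The point at infinity `P_∞`: the (unique) common pole of `x` and `y`. -/
def Pinf : Place k (FnField k q) := (exists_place_infinity k q).choose

/-- The origin `P_0`: the (unique) common zero of `x` and `y`. -/
def P0 : Place k (FnField k q) := (exists_place_origin k q).choose

/-- The divisor `a P_∞ + b P_0`. -/
def twoPoint (a b : ℤ) : PlaceDivisor k (FnField k q) :=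
  Finsupp.single (Pinf k q) a + Finsupp.single (P0 k q) b

/-- The set `M_{P_∞}(a, b)` of pairs of rational functions. -/
def pairsInf (a b : ℤ) : Set (FnField k q × FnField k q) :=
  {p | p.1 * p.2 ∈ RRSpace (twoPoint k q a b) \ RRSpace (twoPoint k q (a - 1) b) ∧
    p.1 ∈ RRSpace (twoPoint k q a b) ∧ p.2 ∈ RRSpace (twoPoint k q (a + b) 0)}

/-- The multiplicity `m_{P_∞}(a, b)`. -/
def multInf (a b : ℤ) : ℕ :=
  {i : ℤ | -b ≤ i ∧ i ≤ a + 1 ∧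
    ∃ f g, (f, g) ∈ pairsInf k q (a + 1) b ∧ (Pinf k q).ord f = -i}.ncard

/-- The set `M_{P_0}(a, b)` of pairs of rational functions. -/
def pairsZero (a b : ℤ) : Set (FnField k q × FnField k q) :=
  {p | p.1 * p.2 ∈ RRSpace (twoPoint k q a b) \ RRSpace (twoPoint k q a (b - 1)) ∧
    p.1 ∈ RRSpace (twoPoint k q a b) ∧ p.2 ∈ RRSpace (twoPoint k q 0 (a + b))}

/-- The multiplicity `m_{P_0}(a, b)`. -/
def multZero (a b : ℤ) : ℕ :=
  {j : ℤ | -a ≤ j ∧ j ≤ b + 1 ∧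
    ∃ f g, (f, g) ∈ pairsZero k q a (b + 1) ∧ (P0 k q).ord f = -j}.ncard

end

/-- The genus `q (q - 1) / 2` of the Hermitian curve. -/
def genus (q : ℕ) : ℕ := q * (q - 1) / 2

end Hermitian

end

noncomputable section

open IsDedekindDomain WithZero

/-! Functions regular outside `P_∞` and `P_0` are exactly the linear combinations of monomials `x ^
s * y ^ t` with `0 ≤ s ≤ q` and `t ∈ ℤ` (`mem_span_mono`). Such a monomial has order `s + t (q + 1)`
at `P_0` and `-(s q + t (q + 1))` at `P_∞`, and at each point these orders are pairwise distinct. So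
the order of a combination is the least order among its terms, and `f` and `g` may be replaced by
monomials (`exists_mono_of_regular`, `multInf_set_eq`).

The multiplicity thus becomes a count of exponents. For each `s` the admissible `t` form an
interval: the lower end comes from the bound at `P_0`, the upper end from requiring the
complementary pole order to be a pole number of functions regular outside `P_∞`. Adding the interval
lengths (`ncard_poleNumbers`) gives one sum, and the three cases record which summands are truncated
to zero.

The involution `x ↦ x / y`, `y ↦ 1 / y` exchanges the two points and reduces the statements at `P_0`
to those at `P_∞`.

All this needs orders to be genuine discrete valuations. The affine coordinate ring is étale over
`k[x]`, hence Dedekind, so its places come from primes; the involution covers the place at infinity.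
-/

/-! ### The coordinate ring is a Dedekind domain -/

theorem formallyUnramified_of_adjoin_singleton {A B : Type*} [CommRing A] [CommRing B] [Algebra A B]
    {b : B} (hb : Algebra.adjoin A {b} = ⊤) {p : A[X]} (hp : aeval b p = 0)
    (hp' : IsUnit (aeval b (derivative p))) : Algebra.FormallyUnramified A B := by
  -- Differentiating `p(b) = 0` gives `p'(b) • D b = 0`, and `p'(b)` is a unit.
  have hD : KaehlerDifferential.D A B = 0 := by
    refine Derivation.ext_of_adjoin_eq_top _ hb ?_
    intro z hz
    rw [Set.mem_singleton_iff.1 hz]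
    have h := Derivation.map_aeval (KaehlerDifferential.D A B) p b
    rw [hp, map_zero] at h
    exact (hp'.smul_eq_zero).1 h.symm
  rw [Algebra.formallyUnramified_iff]
  have h := KaehlerDifferential.span_range_derivation A B
  rw [hD] at h
  refine (Submodule.subsingleton_iff B).1 (subsingleton_of_bot_eq_top ?_)
  rw [← h, eq_comm, Submodule.span_eq_bot]
  rintro _ ⟨z, rfl⟩
  rfl

/-- A finite unramified domain extension of a Dedekind domain is Dedekind. The base map is an
explicit `φ` because `CoordRing` already carries a `k[X]`-algebra structure with `X ↦ y`, while the
étale projection is `X ↦ x`. -/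
theorem isDedekindDomain_of_adjoin_singleton {A B : Type*} [CommRing A] [IsDedekindDomain A]
    [CommRing B] [IsDomain B] (φ : A →+* B) {b : B} {p : A[X]} (hpm : p.Monic)
    (hb : ∀ S : Subring B, (∀ a, φ a ∈ S) → b ∈ S → S = ⊤) (hp : eval₂ φ b p = 0)
    (hp' : IsUnit (eval₂ φ b (derivative p))) : IsDedekindDomain B := by
  let := φ.toAlgebra
  have htop : Algebra.adjoin A {b} = ⊤ := by
    have h := hb (Algebra.adjoin A {b}).toSubring (fun a => Subalgebra.algebraMap_mem _ a)
      (Algebra.self_mem_adjoin_singleton A b)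
    refine Algebra.eq_top_iff.2 fun z => ?_
    have hz : z ∈ (Algebra.adjoin A {b}).toSubring := h ▸ Subring.mem_top z
    exact hz
  have := formallyUnramified_of_adjoin_singleton htop hp hp'
  have : Module.Finite A B := by
    have hfg := IsIntegral.fg_adjoin_singleton (R := A) (B := B) (x := b) ⟨p, hpm, hp⟩
    rw [htop] at hfg
    exact ⟨hfg⟩
  exact isDedekindDomain.of_formallyUnramified A B

namespace Hermitian

variable (k : Type*) [Field k] (q : ℕ)

theorem natCast_eq_zero_of_card (hk : Nat.card k = q ^ 2) : (q : k) = 0 := by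
  have h : ((Nat.card k : ℕ) : k) = 0 := by
    rcases finite_or_infinite k with h | h
    · have := Fintype.ofFinite k
      rw [Nat.card_eq_fintype_card]
      exact FiniteField.cast_card_eq_zero k
    -- For infinite `k` the value `Nat.card k` is `0` by convention, so its cast vanishes here too.
    · simp
  rw [hk] at h
  push_cast at h
  exact pow_eq_zero_iff (two_ne_zero) |>.1 h

theorem coordRing_subring_eq_top {S : Subring (CoordRing k q)}
    (hk : ∀ c, algebraMap k (CoordRing k q) c ∈ S)
    (hx : AdjoinRoot.root (poly k q) ∈ S) (hy : AdjoinRoot.of (poly k q) X ∈ S) : S = ⊤ := by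
  have hof : ∀ r : k[X], AdjoinRoot.of (poly k q) r ∈ S := by
    intro r
    induction r using Polynomial.induction_on' with
    | add r s hr hs => rw [map_add]; exact add_mem hr hs
    | monomial n c =>
      rw [← C_mul_X_pow_eq_monomial, map_mul, map_pow]
      exact mul_mem (hk c) (pow_mem hy n)
  rw [eq_top_iff]
  intro z _
  induction z using AdjoinRoot.induction_on with
  | ih p =>
    induction p using Polynomial.induction_on' with
    | add r s hr hs => rw [map_add]; exact add_mem (hr trivial) (hs trivial)
    | monomial n c =>
      rw [← C_mul_X_pow_eq_monomial, map_mul, map_pow, AdjoinRoot.mk_C, AdjoinRoot.mk_X]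
      exact mul_mem (hof c) (pow_mem hx n)

theorem coordRing_equation : AdjoinRoot.of (poly k q) X ^ q + AdjoinRoot.of (poly k q) X
    = AdjoinRoot.root (poly k q) ^ (q + 1) := by
  have h1 := AdjoinRoot.eval₂_root (poly k q)
  rw [poly, eval₂_sub, eval₂_X_pow, eval₂_C, sub_eq_zero] at h1
  rw [← map_pow, ← map_add]
  exact h1.symm

variable [hq : Fact (IsPrimePow q)]

/-- Over `k[x]` the function `y` is a root of `Y ^ q + Y - x ^ (q + 1)`, whose derivative is `1`
because `q = 0` in `k`. -/
theorem isDedekindDomain_coordRing (hk : Nat.card k = q ^ 2) :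
    IsDedekindDomain (CoordRing k q) := by
  have hq1 : 1 < q := hq.out.one_lt
  have hq0 : (q : CoordRing k q) = 0 := by
    have h := congrArg (algebraMap k (CoordRing k q)) (natCast_eq_zero_of_card k q hk)
    rwa [map_natCast, map_zero] at h
  let φ : k[X] →+* CoordRing k q :=
    (aeval (R := k) (AdjoinRoot.root (poly k q))).toRingHom
  have hφX : φ X = AdjoinRoot.root (poly k q) := aeval_X _
  refine isDedekindDomain_of_adjoin_singleton φ (b := AdjoinRoot.of (poly k q) X)
    (p := X ^ q + (X - C (X ^ (q + 1)))) ?_ ?_ ?_ ?_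
  · refine monic_X_pow_add ?_
    rw [degree_X_sub_C]
    exact_mod_cast hq1
  · intro S hS hb
    refine coordRing_subring_eq_top k q (fun c => ?_) (hφX ▸ hS X) hb
    have : φ (C c) = algebraMap k (CoordRing k q) c := aeval_C _ _
    exact this ▸ hS (C c)
  · rw [eval₂_add, eval₂_X_pow, eval₂_sub, eval₂_X, eval₂_C, ← add_sub_assoc, map_pow, hφX,
      coordRing_equation, sub_self]
  · rw [derivative_add, derivative_sub, derivative_X_pow, derivative_X, derivative_C]
    simp [hq0]

end Hermitian

/-! ### Places as discrete valuations -/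

/-- A proper valuation ring of the fraction field of a Dedekind domain `R` that contains `R` is the
valuation ring of a nonzero prime of `R`. -/
theorem ValuationSubring.exists_heightOneSpectrum {R F : Type*} [CommRing R] [IsDedekindDomain R]
    [Field F] [Algebra R F] [IsFractionRing R F] {V : ValuationSubring F} (hV : V ≠ ⊤)
    (hR : ∀ r : R, algebraMap R F r ∈ V) :
    ∃ v : HeightOneSpectrum R, (v.valuation F).valuationSubring = V ∧
      ∀ r : R, algebraMap R F r ∈ V.nonunits ↔ r ∈ v.asIdeal := by
  let j : R →+* V := (algebraMap R F).codRestrict V hR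
  let p : Ideal R := (IsLocalRing.maximalIdeal V).comap j
  have hp : ∀ r : R, algebraMap R F r ∈ V.nonunits ↔ r ∈ p := fun r => V.coe_mem_nonunits_iff (a := j r)
  have hunit : ∀ r : R, r ∉ p → (algebraMap R F r)⁻¹ ∈ V := by
    intro r hr
    by_contra h
    exact hr ((hp r).1 (V.mem_nonunits_iff_or.2 (Or.inr h)))
  -- If the centre were zero, `V` would contain the inverse of every nonzero element of `R`, hence
  -- all of `F`.
  have hp0 : p ≠ ⊥ := by
    intro h
    apply hV
    rw [_root_.eq_top_iff]
    intro z _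
    obtain ⟨a, b, hb, rfl⟩ := IsFractionRing.div_surjective (A := R) z
    rw [div_eq_mul_inv]
    refine MulMemClass.mul_mem (hR a) (hunit b ?_)
    rw [h]
    exact nonZeroDivisors.ne_zero hb
  have hpp : p.IsPrime := Ideal.comap_isPrime _ _
  let v : HeightOneSpectrum R := ⟨p, hpp, hp0⟩
  refine ⟨v, ?_, hp⟩
  have hle : (v.valuation F).valuationSubring ≤ V := by
    intro z hz
    obtain ⟨n, d, h⟩ := v.exists_primeCompl_mul_eq_of_integer z hz
    have hd0 : algebraMap R F d ≠ 0 := by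
      rw [Ne, FaithfulSMul.algebraMap_eq_zero_iff]
      intro h0
      exact d.2 (h0 ▸ p.zero_mem)
    rw [eq_div_of_mul_eq hd0 h, div_eq_mul_inv]
    exact MulMemClass.mul_mem (hR n) (hunit d d.2)
  rw [← v.valuationSubringAtPrime_eq_valuationSubring] at hle ⊢
  exact ValuationSubring.eq_of_le_of_ne_top _ hle hV

namespace Place

variable {k F : Type*} [Field k] [Field F] [Algebra k F]

@[ext]
theorem ext {P Q : Place k F} (h : P.ring = Q.ring) : P = Q := by
  cases P
  cases Q
  cases h
  rfl

/-- The normalized discrete valuation `v` defines the place `P`. -/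
def IsValuation (P : Place k F) (v : Valuation F ℤᵐ⁰) : Prop :=
  v.valuationSubring = P.ring ∧ ∃ t, v t = exp (-1)

/-- `P` is defined by a normalized discrete valuation. -/
def IsDiscrete (P : Place k F) : Prop := ∃ v, P.IsValuation v

variable {P : Place k F} {v : Valuation F ℤᵐ⁰}

namespace IsValuation

variable (hv : P.IsValuation v)
include hv

theorem mem_ring_iff {f : F} : f ∈ P.ring ↔ v f ≤ 1 := by
  rw [← hv.1, Valuation.mem_valuationSubring_iff]

theorem mem_nonunits_iff {f : F} : f ∈ P.ring.nonunits ↔ v f < 1 := by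
  rw [ValuationSubring.mem_nonunits_iff_or, hv.mem_ring_iff, not_le, map_inv₀]
  by_cases hf : f = 0
  · simp [hf]
  · have h : v f ≠ 0 := (Valuation.ne_zero_iff _).2 hf
    rw [one_lt_inv₀ (zero_lt_iff.2 h)]
    simp [hf]

theorem isUniformizer {t : F} (ht : v t = exp (-1)) : P.IsUniformizer t := by
  have ht1 : v t < 1 := by rw [ht, ← exp_zero, exp_lt_exp]; norm_num
  have ht0 : t ≠ 0 := by
    rintro rfl
    rw [map_zero] at ht
    exact exp_ne_zero ht.symm
  refine ⟨hv.mem_ring_iff.2 ht1.le, ?_⟩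
  ext ⟨z, hz⟩
  rw [← ValuationSubring.coe_mem_nonunits_iff, hv.mem_nonunits_iff, Ideal.mem_span_singleton]
  constructor
  · intro h
    -- The value group is discrete: nothing lies strictly between `exp (-1)` and `1`.
    have h1 : v z ≤ exp (-1) := by
      by_cases h0 : v z = 0
      · rw [h0]; exact zero_le
      · rw [← log_le_iff_le_exp h0]
        rw [← exp_zero, ← log_lt_iff_lt_exp h0] at h
        change log (v z) < 0 at h
        omega
    have h2 : z / t ∈ P.ring := by
      rw [hv.mem_ring_iff, map_div₀, ht]
      exact div_le_one_of_le₀ h1 zero_le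
    exact ⟨⟨z / t, h2⟩, Subtype.ext (mul_div_cancel₀ z ht0).symm⟩
  · rintro ⟨w, hw⟩
    have hw' : z = t * w := congrArg Subtype.val hw
    change v z < 1
    rw [hw', map_mul]
    exact mul_lt_one_of_lt_of_le ht1 (hv.mem_ring_iff.1 w.2)

theorem hasOrd {f : F} (hf : f ≠ 0) : P.HasOrd f (-log (v f)) := by
  obtain ⟨t, ht⟩ := hv.2
  have hvf : v f ≠ 0 := (Valuation.ne_zero_iff _).2 hf
  have ht0 : t ≠ 0 := by
    rintro rfl
    rw [map_zero] at ht
    exact exp_ne_zero ht.symm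
  set n : ℤ := -log (v f) with hn
  set u : F := f * t ^ (-n) with hu
  have hvu : v u = 1 := by
    rw [hu, map_mul, map_zpow₀, ht, ← exp_zsmul, ← exp_log hvf, ← exp_add, hn]
    simp
  have hu1 : u ∈ P.ring := hv.mem_ring_iff.2 hvu.le
  have hu2 : u⁻¹ ∈ P.ring := hv.mem_ring_iff.2 (by rw [map_inv₀, hvu, inv_one])
  have hu0 : u ≠ 0 := by
    intro h
    rw [h, map_zero] at hvu
    exact zero_ne_one hvu
  refine ⟨⟨⟨u, hu1⟩, ⟨u⁻¹, hu2⟩, Subtype.ext (mul_inv_cancel₀ hu0),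
    Subtype.ext (inv_mul_cancel₀ hu0)⟩, t, hv.isUniformizer ht, ?_⟩
  change f = f * t ^ (-n) * t ^ n
  rw [mul_assoc, ← zpow_add₀ ht0, neg_add_cancel, zpow_zero, mul_one]

/-- `ord` is a choice of witness, and `HasOrd.unique` pins it down; from here on orders can be
computed with `v`. -/
theorem ord_eq {f : F} (hf : f ≠ 0) : P.ord f = -log (v f) := by
  have h : ∃ n : ℤ, P.HasOrd f n := ⟨_, hv.hasOrd hf⟩
  rw [ord, dif_pos h]
  exact HasOrd.unique P h.choose_spec (hv.hasOrd hf)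

theorem apply_eq {f : F} (hf : f ≠ 0) : v f = exp (-P.ord f) := by
  rw [hv.ord_eq hf, neg_neg, exp_log ((Valuation.ne_zero_iff _).2 hf)]

end IsValuation

namespace IsDiscrete

variable (hP : P.IsDiscrete)
include hP

theorem ord_mul {f g : F} (hf : f ≠ 0) (hg : g ≠ 0) : P.ord (f * g) = P.ord f + P.ord g := by
  obtain ⟨v, hv⟩ := hP
  rw [hv.ord_eq (mul_ne_zero hf hg), hv.ord_eq hf, hv.ord_eq hg, map_mul,
    log_mul ((Valuation.ne_zero_iff _).2 hf) ((Valuation.ne_zero_iff _).2 hg), neg_add]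

theorem ord_zpow {f : F} (hf : f ≠ 0) (n : ℤ) : P.ord (f ^ n) = n * P.ord f := by
  obtain ⟨v, hv⟩ := hP
  rw [hv.ord_eq (zpow_ne_zero n hf), hv.ord_eq hf, map_zpow₀, log_zpow, smul_eq_mul, mul_neg]

theorem ord_pow {f : F} (hf : f ≠ 0) (n : ℕ) : P.ord (f ^ n) = n * P.ord f := by
  rw [← zpow_natCast, hP.ord_zpow hf]

theorem ord_nonneg_iff {f : F} (hf : f ≠ 0) : 0 ≤ P.ord f ↔ f ∈ P.ring := by
  obtain ⟨v, hv⟩ := hP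
  rw [hv.mem_ring_iff, hv.apply_eq hf, ← exp_zero, exp_le_exp]
  omega

theorem ord_pos_iff {f : F} (hf : f ≠ 0) : 0 < P.ord f ↔ f ∈ P.ring.nonunits := by
  obtain ⟨v, hv⟩ := hP
  rw [hv.mem_nonunits_iff, hv.apply_eq hf, ← exp_zero, exp_lt_exp]
  omega

theorem ord_algebraMap {c : k} (hc : c ≠ 0) : P.ord (algebraMap k F c) = 0 := by
  have h0 : algebraMap k F c ≠ 0 := by simpa using hc
  have h1 := (hP.ord_nonneg_iff h0).2 (P.algebraMap_mem c)
  have h2 := (hP.ord_nonneg_iff (inv_ne_zero h0)).2 (map_inv₀ (algebraMap k F) c ▸ P.algebraMap_mem c⁻¹)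
  have h3 := hP.ord_zpow h0 (-1)
  rw [zpow_neg_one] at h3
  omega

/-- If the terms of a sum have pairwise distinct orders, then the order of the sum is the
smallest one. -/
theorem exists_ord_sum_eq {ι : Type*} {T : Finset ι} (hT : T.Nonempty) {f : ι → F}
    (hf : ∀ i ∈ T, f i ≠ 0) (hinj : Set.InjOn (fun i => P.ord (f i)) T) :
    ∃ i ∈ T, P.ord (∑ j ∈ T, f j) = P.ord (f i) ∧ ∀ j ∈ T, P.ord (f i) ≤ P.ord (f j) := by
  classical
  obtain ⟨v, hv⟩ := hP
  obtain ⟨i, hi, hmin⟩ := T.exists_min_image (fun i => P.ord (f i)) hT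
  refine ⟨i, hi, ?_, hmin⟩
  have hsum : v (∑ j ∈ T, f j) = v (f i) := by
    refine v.map_sum_eq_of_lt hi fun j hj => ?_
    rw [Finset.mem_sdiff, Finset.mem_singleton] at hj
    rw [hv.apply_eq (hf i hi), hv.apply_eq (hf j hj.1), exp_lt_exp, neg_lt_neg_iff]
    exact lt_of_le_of_ne (hmin j hj.1) fun h => hj.2 (hinj hj.1 hi h.symm)
  have h0 : ∑ j ∈ T, f j ≠ 0 := by
    rw [← Valuation.ne_zero_iff v, hsum, Valuation.ne_zero_iff]
    exact hf i hi
  rw [hv.ord_eq h0, hsum, hv.ord_eq (hf i hi)]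

end IsDiscrete

theorem IsDiscrete.of_ring_eq {P : Place k F} {R : Type*} [CommRing R] [IsDedekindDomain R]
    [Algebra R F] [IsFractionRing R F] {v : HeightOneSpectrum R}
    (h : (v.valuation F).valuationSubring = P.ring) : P.IsDiscrete :=
  ⟨v.valuation F, h, v.valuation_exists_uniformizer F⟩

/-- The preimage of a place under an automorphism. -/
def comap (P : Place k F) (σ : F ≃ₐ[k] F) : Place k F where
  ring := P.ring.comap (σ : F →+* F)
  algebraMap_mem c := by
    rw [ValuationSubring.mem_comap]
    simpa using P.algebraMap_mem c
  ne_top h := by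
    apply P.ne_top
    rw [eq_top_iff]
    intro z _
    have h1 : σ.symm z ∈ P.ring.comap (σ : F →+* F) := h ▸ ValuationSubring.mem_top _
    rw [ValuationSubring.mem_comap] at h1
    simpa using h1

theorem mem_comap_ring {P : Place k F} {σ : F ≃ₐ[k] F} {f : F} :
    f ∈ (P.comap σ).ring ↔ σ f ∈ P.ring := Iff.rfl

theorem mem_comap_nonunits {P : Place k F} {σ : F ≃ₐ[k] F} {f : F} :
    f ∈ (P.comap σ).ring.nonunits ↔ σ f ∈ P.ring.nonunits := by
  rw [ValuationSubring.mem_nonunits_iff_or, ValuationSubring.mem_nonunits_iff_or, mem_comap_ring,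
    map_inv₀, EmbeddingLike.map_eq_zero_iff]

theorem comap_comap (P : Place k F) (σ τ : F ≃ₐ[k] F) :
    (P.comap σ).comap τ = P.comap (τ.trans σ) := rfl

theorem comap_refl (P : Place k F) : P.comap AlgEquiv.refl = P := rfl

theorem IsValuation.comap (hv : P.IsValuation v) (σ : F ≃ₐ[k] F) :
    (P.comap σ).IsValuation (v.comap (σ : F →+* F)) := by
  refine ⟨?_, ?_⟩
  · ext f
    rw [Valuation.mem_valuationSubring_iff, mem_comap_ring, hv.mem_ring_iff]
    rfl
  · obtain ⟨t, ht⟩ := hv.2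
    refine ⟨σ.symm t, ?_⟩
    rw [Valuation.comap_apply]
    simpa using ht

theorem IsDiscrete.comap (hP : P.IsDiscrete) (σ : F ≃ₐ[k] F) : (P.comap σ).IsDiscrete :=
  let ⟨_, hv⟩ := hP
  ⟨_, hv.comap σ⟩

theorem IsDiscrete.ord_comap (hP : P.IsDiscrete) (σ : F ≃ₐ[k] F) {f : F} (hf : f ≠ 0) :
    (P.comap σ).ord f = P.ord (σ f) := by
  obtain ⟨v, hv⟩ := hP
  rw [(hv.comap σ).ord_eq hf, hv.ord_eq (by simpa using hf)]
  rfl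

end Place

/-! ### The origin and the involution exchanging the two points -/

namespace Hermitian

variable (k : Type*) [Field k] (q : ℕ)

theorem y_ne_zero : y k q ≠ 0 := fun h => y_transcendental k q (h ▸ isAlgebraic_zero)

theorem exists_sub_algebraMap_mem_span (r : CoordRing k q) : ∃ c : k,
    r - algebraMap k (CoordRing k q) c ∈
      Ideal.span {AdjoinRoot.root (poly k q), AdjoinRoot.of (poly k q) X} := by
  set I := Ideal.span {AdjoinRoot.root (poly k q), AdjoinRoot.of (poly k q) X} with hI
  have h : ((algebraMap (CoordRing k q) (CoordRing k q ⧸ I)).comp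
      (algebraMap k (CoordRing k q))).range.comap (Ideal.Quotient.mk I) = ⊤ := by
    refine coordRing_subring_eq_top k q (fun c => ⟨c, rfl⟩) ⟨0, ?_⟩ ⟨0, ?_⟩
    · rw [map_zero, eq_comm, Ideal.Quotient.eq_zero_iff_mem]
      exact Ideal.subset_span (by simp)
    · rw [map_zero, eq_comm, Ideal.Quotient.eq_zero_iff_mem]
      exact Ideal.subset_span (by simp)
  obtain ⟨c, hc⟩ : r ∈ ((algebraMap (CoordRing k q) (CoordRing k q ⧸ I)).comp
      (algebraMap k (CoordRing k q))).range.comap (Ideal.Quotient.mk I) := h ▸ Subring.mem_top r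
  exact ⟨c, Ideal.Quotient.eq.1 hc.symm⟩

/-- Modulo `(x, y)` every function is a constant, so `(x, y)` has no proper ideal strictly above it.
-/
theorem eq_span_of_mem {I : Ideal (CoordRing k q)} (hI : I ≠ ⊤)
    (hx : AdjoinRoot.root (poly k q) ∈ I) (hy : AdjoinRoot.of (poly k q) X ∈ I) :
    I = Ideal.span {AdjoinRoot.root (poly k q), AdjoinRoot.of (poly k q) X} := by
  have hle : Ideal.span {AdjoinRoot.root (poly k q), AdjoinRoot.of (poly k q) X} ≤ I := by
    rw [Ideal.span_le]
    rintro _ (rfl | rfl)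
    · exact hx
    · exact hy
  refine le_antisymm (fun r hr => ?_) hle
  obtain ⟨c, hc⟩ := exists_sub_algebraMap_mem_span k q r
  have hcI : algebraMap k (CoordRing k q) c ∈ I := by
    have := I.sub_mem hr (hle hc)
    rwa [sub_sub_cancel] at this
  by_cases hc0 : c = 0
  · rwa [hc0, map_zero, sub_zero] at hc
  · exact absurd (I.eq_top_of_isUnit_mem hcI ((isUnit_iff_ne_zero.2 hc0).map _)) hI

variable [hq : Fact (IsPrimePow q)]

theorem transcendental_inv_y : Transcendental k (y k q)⁻¹ := fun h =>
  y_transcendental k q (inv_inv (y k q) ▸ h.inv)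

theorem y_pow_pred_add_one : y k q * (y k q ^ (q - 1) + 1) = x k q ^ (q + 1) := by
  rw [← curve_equation, mul_add, mul_one, ← pow_succ', Nat.sub_add_cancel hq.out.one_lt.le]

theorem x_ne_zero : x k q ≠ 0 := by
  intro h
  have h1 := y_pow_pred_add_one k q
  rw [h, zero_pow (Nat.succ_ne_zero q)] at h1
  have h2 := (mul_eq_zero.1 h1).resolve_left (y_ne_zero k q)
  have hq1 : 0 < q - 1 := Nat.sub_pos_of_lt hq.out.one_lt
  refine y_transcendental k q ⟨X ^ (q - 1) + C 1, (monic_X_pow_add_C _ hq1.ne').ne_zero, ?_⟩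
  simpa using h2

variable {k q}

theorem y_mem_ring_of_x_mem {P : Place k (FnField k q)} (hx : x k q ∈ P.ring) :
    y k q ∈ P.ring := by
  have hint : IsIntegral P.ring (y k q) := by
    refine ⟨X ^ q + (X - C ⟨x k q ^ (q + 1), pow_mem hx _⟩), ?_, ?_⟩
    · refine monic_X_pow_add ?_
      rw [degree_X_sub_C]
      exact_mod_cast hq.out.one_lt
    · rw [eval₂_add, eval₂_X_pow, eval₂_sub, eval₂_X, eval₂_C, ← add_sub_assoc, curve_equation]
      exact sub_self _
  obtain ⟨v, hv⟩ := IsIntegrallyClosed.isIntegral_iff.1 hint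
  rw [← hv]
  exact v.2

theorem x_mem_nonunits_of_y_mem {P : Place k (FnField k q)} (hy : y k q ∈ P.ring.nonunits) :
    x k q ∈ P.ring.nonunits := by
  have h : x k q ^ (q + 1) ∈ P.ring.nonunits := by
    rw [← curve_equation]
    refine add_mem ?_ hy
    rw [ValuationSubring.mem_nonunits_iff] at hy
    rw [ValuationSubring.mem_nonunits_iff, map_pow]
    exact (pow_lt_one_iff_of_nonneg zero_le (Nat.ne_zero_of_lt hq.out.one_lt)).2 hy
  rw [ValuationSubring.mem_nonunits_iff, map_pow] at h
  rw [ValuationSubring.mem_nonunits_iff]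
  exact (pow_lt_one_iff_of_nonneg zero_le (Nat.succ_ne_zero q)).1 h

theorem coordRing_mem_ring {P : Place k (FnField k q)} (hx : x k q ∈ P.ring) (r : CoordRing k q) :
    algebraMap (CoordRing k q) (FnField k q) r ∈ P.ring := by
  have h : P.ring.toSubring.comap (algebraMap (CoordRing k q) (FnField k q)) = ⊤ := by
    refine coordRing_subring_eq_top k q (fun c => ?_) hx (y_mem_ring_of_x_mem hx)
    rw [Subring.mem_comap, ← IsScalarTower.algebraMap_apply]
    exact P.algebraMap_mem c
  have h1 : r ∈ P.ring.toSubring.comap (algebraMap (CoordRing k q) (FnField k q)) :=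
    h ▸ Subring.mem_top r
  exact h1

variable (k q)

/-- Divide the curve equation by `y ^ (q + 1)`. -/
theorem eval₂_swap_poly :
    eval₂ (aeval (R := k) (y k q)⁻¹).toRingHom (x k q / y k q) (poly k q) = 0 := by
  have hy := y_ne_zero k q
  have hy' : aeval (y k q)⁻¹ (X ^ q + X : k[X]) = (y k q ^ q)⁻¹ + (y k q)⁻¹ := by simp
  change eval₂ _ _ (X ^ (q + 1) - C (X ^ q + X)) = 0
  rw [eval₂_sub, eval₂_X_pow, eval₂_C, div_pow, ← curve_equation]
  change _ - aeval (y k q)⁻¹ (X ^ q + X : k[X]) = 0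
  rw [hy']
  field_simp
  ring

/-- The homomorphism from the coordinate ring to the function field with `x ↦ x / y` and
`y ↦ 1 / y`. -/
def swapCoord : CoordRing k q →+* FnField k q :=
  AdjoinRoot.lift (aeval (R := k) (y k q)⁻¹).toRingHom (x k q / y k q) (eval₂_swap_poly k q)

theorem swapCoord_root : swapCoord k q (AdjoinRoot.root (poly k q)) = x k q / y k q :=
  AdjoinRoot.lift_root _

theorem swapCoord_of (p : k[X]) :
    swapCoord k q (AdjoinRoot.of (poly k q) p) = aeval (y k q)⁻¹ p :=
  AdjoinRoot.lift_of _

theorem swapCoord_algebraMap (c : k) :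
    swapCoord k q (algebraMap k (CoordRing k q) c) = algebraMap k (FnField k q) c := by
  have h : algebraMap k (CoordRing k q) c = AdjoinRoot.of (poly k q) (C c) := rfl
  rw [h, swapCoord_of, aeval_C]

/-- `CoordRing` is integral over `k[y]`, so a nonzero kernel would meet `k[y]` nontrivially, against
the transcendence of `1 / y`. -/
theorem swapCoord_injective : Function.Injective (swapCoord k q) := by
  rw [injective_iff_map_eq_zero]
  intro r hr
  by_contra hr0
  have hfin : Module.Finite k[X] (CoordRing k q) := (poly_monic k q).finite_adjoinRoot
  have hint : IsIntegral k[X] r := Algebra.IsIntegral.isIntegral r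
  obtain ⟨p, hp, hp0⟩ := Submodule.exists_mem_ne_zero_of_ne_bot
    (Ideal.comap_ne_bot_of_integral_mem hr0 ((RingHom.mem_ker (f := swapCoord k q)).2 hr) hint)
  refine transcendental_inv_y k q ⟨p, hp0, ?_⟩
  rw [← swapCoord_of]
  exact (RingHom.mem_ker).1 (Ideal.mem_comap.1 hp)

/-- The endomorphism of the function field with `x ↦ x / y` and `y ↦ 1 / y`. -/
def swapHom : FnField k q →+* FnField k q :=
  IsFractionRing.lift (swapCoord_injective k q)

theorem swapHom_algebraMap (c : k) :
    swapHom k q (algebraMap k (FnField k q) c) = algebraMap k (FnField k q) c := by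
  rw [IsScalarTower.algebraMap_apply k (CoordRing k q), swapHom, IsFractionRing.lift_algebraMap,
    swapCoord_algebraMap, ← IsScalarTower.algebraMap_apply]

theorem swapHom_x : swapHom k q (x k q) = x k q / y k q := by
  rw [x, swapHom, IsFractionRing.lift_algebraMap, swapCoord_root]
  rfl

theorem swapHom_y : swapHom k q (y k q) = (y k q)⁻¹ := by
  rw [y, swapHom, IsFractionRing.lift_algebraMap, swapCoord_of, aeval_X]
  rfl

theorem swapHom_comp_swapHom : (swapHom k q).comp (swapHom k q) = RingHom.id _ := by
  refine IsFractionRing.ringHom_ext (A := CoordRing k q) fun r => ?_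
  have h : (((swapHom k q).comp (swapHom k q)).comp (algebraMap (CoordRing k q) (FnField k q))).eqLocus
      (algebraMap (CoordRing k q) (FnField k q)) = ⊤ := by
    refine coordRing_subring_eq_top k q (fun c => ?_) ?_ ?_
    · change swapHom k q (swapHom k q _) = _
      rw [← IsScalarTower.algebraMap_apply, swapHom_algebraMap, swapHom_algebraMap]
    · change swapHom k q (swapHom k q (x k q)) = x k q
      have := y_ne_zero k q
      rw [swapHom_x, map_div₀, swapHom_x, swapHom_y]
      field_simp
    · change swapHom k q (swapHom k q (y k q)) = y k q
      rw [swapHom_y, map_inv₀, swapHom_y, inv_inv]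
  have h1 : r ∈ (((swapHom k q).comp (swapHom k q)).comp
      (algebraMap (CoordRing k q) (FnField k q))).eqLocus
      (algebraMap (CoordRing k q) (FnField k q)) := h ▸ Subring.mem_top r
  exact h1

/-- The involution of the function field that exchanges `P_∞` and `P_0`. -/
def swap : FnField k q ≃ₐ[k] FnField k q :=
  AlgEquiv.ofRingEquiv (f := RingEquiv.ofRingHom (swapHom k q) (swapHom k q)
    (swapHom_comp_swapHom k q) (swapHom_comp_swapHom k q)) (swapHom_algebraMap k q)

theorem swap_x : swap k q (x k q) = x k q / y k q := swapHom_x k q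

theorem swap_y : swap k q (y k q) = (y k q)⁻¹ := swapHom_y k q

theorem swap_swap (f : FnField k q) : swap k q (swap k q f) = f :=
  RingHom.congr_fun (swapHom_comp_swapHom k q) f

theorem swap_trans_swap : (swap k q).trans (swap k q) = AlgEquiv.refl :=
  AlgEquiv.ext (swap_swap k q)

theorem comap_swap_comap_swap (P : Place k (FnField k q)) :
    (P.comap (swap k q)).comap (swap k q) = P := by
  rw [Place.comap_comap, swap_trans_swap, Place.comap_refl]

theorem swap_mem_nonunits {P : Place k (FnField k q)} (hy : y k q ∉ P.ring) :
    x k q ∈ (P.comap (swap k q)).ring.nonunits ∧ y k q ∈ (P.comap (swap k q)).ring.nonunits := by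
  have h : y k q ∈ (P.comap (swap k q)).ring.nonunits := by
    rw [Place.mem_comap_nonunits, swap_y, ValuationSubring.inv_mem_nonunits_iff]
    exact Or.inr hy
  exact ⟨x_mem_nonunits_of_y_mem h, h⟩

theorem x_mem_of_y_mem {P : Place k (FnField k q)} (hy : y k q ∈ P.ring) :
    x k q ∈ P.ring := by
  have h : x k q ^ (q + 1) ∈ P.ring := by
    rw [← curve_equation]
    exact add_mem (pow_mem hy _) hy
  rw [← ValuationSubring.valuation_le_one_iff, map_pow] at h
  rw [← ValuationSubring.valuation_le_one_iff]
  exact (pow_le_one_iff_of_nonneg zero_le (Nat.succ_ne_zero q)).1 h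

/-! ### Discreteness of all places and local orders at the origin -/

section

variable {k q} [IsDedekindDomain (CoordRing k q)]

theorem exists_heightOneSpectrum {P : Place k (FnField k q)} (hx : x k q ∈ P.ring) :
    ∃ v : HeightOneSpectrum (CoordRing k q),
      (v.valuation (FnField k q)).valuationSubring = P.ring ∧
      ∀ r : CoordRing k q, algebraMap (CoordRing k q) (FnField k q) r ∈ P.ring.nonunits ↔
        r ∈ v.asIdeal :=
  ValuationSubring.exists_heightOneSpectrum P.ne_top (coordRing_mem_ring hx)

/-- A place where `x` is regular comes from a prime of the coordinate ring. At any other place `y`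
has a pole, and the involution moves it to a place where `x` and `y` vanish. -/
theorem isDiscrete (P : Place k (FnField k q)) : P.IsDiscrete := by
  by_cases hx : x k q ∈ P.ring
  · obtain ⟨v, hv, -⟩ := exists_heightOneSpectrum hx
    exact Place.IsDiscrete.of_ring_eq hv
  · have hy : y k q ∉ P.ring := fun h => hx (x_mem_of_y_mem k q h)
    have hx' := ValuationSubring.nonunits_subset (swap_mem_nonunits k q hy).1
    obtain ⟨v, hv, -⟩ := exists_heightOneSpectrum (P := P.comap (swap k q)) hx'
    have h := (Place.IsDiscrete.of_ring_eq hv).comap (swap k q)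
    rwa [comap_swap_comap_swap] at h

theorem place_eq_of_y_mem_nonunits {P Q : Place k (FnField k q)}
    (hP : y k q ∈ P.ring.nonunits) (hQ : y k q ∈ Q.ring.nonunits) : P = Q := by
  have key : ∀ P : Place k (FnField k q), y k q ∈ P.ring.nonunits →
      ∃ v : HeightOneSpectrum (CoordRing k q),
      (v.valuation (FnField k q)).valuationSubring = P.ring ∧
      v.asIdeal = Ideal.span {AdjoinRoot.root (poly k q), AdjoinRoot.of (poly k q) X} := by
    intro P hy
    have hx := x_mem_nonunits_of_y_mem hy
    obtain ⟨v, hv, h⟩ := exists_heightOneSpectrum (ValuationSubring.nonunits_subset hx)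
    exact ⟨v, hv, eq_span_of_mem k q v.isPrime.ne_top ((h _).1 hx) ((h _).1 hy)⟩
  obtain ⟨v, hv, hv'⟩ := key P hP
  obtain ⟨w, hw, hw'⟩ := key Q hQ
  have : v = w := HeightOneSpectrum.ext (hv'.trans hw'.symm)
  exact Place.ext (by rw [← hv, ← hw, this])

/-- In `y (y ^ (q - 1) + 1) = x ^ (q + 1)` the second factor is a unit wherever `y` vanishes. -/
theorem ord_y_of_mem_nonunits {P : Place k (FnField k q)} (hy : y k q ∈ P.ring.nonunits) :
    P.ord (y k q) = (q + 1) * P.ord (x k q) := by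
  have hP := isDiscrete P
  have hq1 : 0 < q - 1 := Nat.sub_pos_of_lt hq.out.one_lt
  have hyq : y k q ^ (q - 1) ∈ P.ring.nonunits := by
    rw [ValuationSubring.mem_nonunits_iff, map_pow] at *
    exact (pow_lt_one_iff_of_nonneg zero_le hq1.ne').2 hy
  have h0 : y k q ^ (q - 1) + 1 ≠ 0 := by
    intro h
    have h1 := y_pow_pred_add_one k q
    rw [h, mul_zero] at h1
    exact pow_ne_zero _ (x_ne_zero k q) h1.symm
  have h1 : P.ord (y k q ^ (q - 1) + 1) = 0 := by
    refine le_antisymm (not_lt.1 fun h => ?_) ((hP.ord_nonneg_iff h0).2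
      (add_mem (ValuationSubring.nonunits_subset hyq) (one_mem _)))
    rw [hP.ord_pos_iff h0] at h
    have h2 := sub_mem h hyq
    rw [add_sub_cancel_left, ValuationSubring.mem_nonunits_iff, map_one] at h2
    exact lt_irrefl _ h2
  have h2 := congrArg P.ord (y_pow_pred_add_one k q)
  rw [hP.ord_mul (y_ne_zero k q) h0, h1, add_zero, hP.ord_pow (x_ne_zero k q)] at h2
  exact_mod_cast h2

/-- The prime is `(x, y)` and `y` has larger order than `x`, so no element of it has smaller order
than `x`; yet it contains an element of order `1`. -/
theorem ord_x_of_mem_nonunits {P : Place k (FnField k q)} (hy : y k q ∈ P.ring.nonunits) :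
    P.ord (x k q) = 1 := by
  have hP := isDiscrete P
  have hx := x_mem_nonunits_of_y_mem hy
  have hx1 := (hP.ord_pos_iff (x_ne_zero k q)).2 hx
  refine le_antisymm ?_ hx1
  obtain ⟨v, hv, h⟩ := exists_heightOneSpectrum (ValuationSubring.nonunits_subset hx)
  have hI := eq_span_of_mem k q v.isPrime.ne_top ((h _).1 hx) ((h _).1 hy)
  have hval : P.IsValuation (v.valuation (FnField k q)) :=
    ⟨hv, v.valuation_exists_uniformizer _⟩
  obtain ⟨π, hπ⟩ := v.valuation_exists_uniformizer' (FnField k q)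
  have hπI : π ∈ v.asIdeal := by
    rw [← v.valuation_lt_one_iff_mem (K := FnField k q)]
    refine lt_of_eq_of_lt hπ ?_
    rw [← exp_zero, exp_lt_exp]
    norm_num
  rw [hI, Ideal.mem_span_pair] at hπI
  obtain ⟨a, b, hab⟩ := hπI
  have hyx : v.valuation (FnField k q) (y k q) ≤ v.valuation (FnField k q) (x k q) := by
    rw [hval.apply_eq (x_ne_zero k q), hval.apply_eq (y_ne_zero k q), exp_le_exp,
      ord_y_of_mem_nonunits hy]
    nlinarith
  have hle : v.valuation (FnField k q) (algebraMap _ _ π) ≤ v.valuation (FnField k q) (x k q) := by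
    rw [← hab, map_add, map_mul, map_mul]
    refine Valuation.map_add_le _ ?_ ?_
    · rw [map_mul]
      exact mul_le_of_le_one_left' (v.valuation_le_one a)
    · rw [map_mul]
      exact (mul_le_of_le_one_left' (v.valuation_le_one b)).trans hyx
  have hle' := hπ.symm.trans_le hle
  rw [hval.apply_eq (x_ne_zero k q), exp_le_exp] at hle'
  omega

end

theorem eq_of_modEq {s s' t t' n : ℤ} (hs : 0 ≤ s) (hs' : 0 ≤ s') (hn : s < n) (hn' : s' < n)
    (h : s + t * n = s' + t' * n) : s = s' ∧ t = t' := by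
  have ht : t = t' := by
    rcases lt_trichotomy t t' with h1 | h1 | h1
    · nlinarith
    · exact h1
    · nlinarith
  subst ht
  exact ⟨by linarith, rfl⟩

/-! ### Monomials and reduction of the multiplicity to exponents -/

section

variable {k : Type*} [Field k] {q : ℕ} [hq : Fact (IsPrimePow q)]

theorem y_mem_P0 : y k q ∈ (P0 k q).ring.nonunits := (exists_place_origin k q).choose_spec.2

theorem y_notMem_Pinf : y k q ∉ (Pinf k q).ring := (exists_place_infinity k q).choose_spec.2

theorem Pinf_ne_P0 : Pinf k q ≠ P0 k q := fun h =>
  y_notMem_Pinf (h ▸ ValuationSubring.nonunits_subset y_mem_P0)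

variable (k q) in
/-- The monomial functions `x ^ s * y ^ t`. -/
def mono (p : ℕ × ℤ) : FnField k q := x k q ^ p.1 * y k q ^ p.2

theorem mono_ne_zero (p : ℕ × ℤ) : mono k q p ≠ 0 :=
  mul_ne_zero (pow_ne_zero _ (x_ne_zero k q)) (zpow_ne_zero _ (y_ne_zero k q))

theorem mk_mul_zpow_mem_span {p : k[X][X]} (hp : p.natDegree ≤ q) (n : ℤ) :
    algebraMap (CoordRing k q) (FnField k q) (AdjoinRoot.mk (poly k q) p) * y k q ^ n ∈
      Submodule.span k (mono k q '' {p | p.1 ≤ q}) := by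
  rw [p.as_sum_range_C_mul_X_pow, map_sum, map_sum, Finset.sum_mul]
  refine Submodule.sum_mem _ fun s hs => ?_
  have hs' : s ≤ q := (Finset.mem_range_succ_iff.1 hs).trans hp
  rw [map_mul, map_pow, AdjoinRoot.mk_C, AdjoinRoot.mk_X, (p.coeff s).as_sum_range_C_mul_X_pow,
    map_sum, Finset.sum_mul, map_sum, Finset.sum_mul]
  refine Submodule.sum_mem _ fun t _ => ?_
  have h : algebraMap (CoordRing k q) (FnField k q) (AdjoinRoot.of (poly k q)
      (C ((p.coeff s).coeff t) * X ^ t) * AdjoinRoot.root (poly k q) ^ s) * y k q ^ n =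
      (p.coeff s).coeff t • mono k q (s, t + n) := by
    rw [Algebra.smul_def, mono, zpow_add₀ (y_ne_zero k q), zpow_natCast, map_mul, map_mul, map_mul,
      map_pow, map_pow, map_pow,
      IsScalarTower.algebraMap_apply k (CoordRing k q) (FnField k q)]
    change _ * y k q ^ t * x k q ^ s * y k q ^ n = _
    rw [mul_assoc, mul_assoc]
    congr 1
    dsimp only
    ring
  rw [h]
  exact Submodule.smul_mem _ _ (Submodule.subset_span ⟨_, hs', rfl⟩)

theorem algebraMap_mul_zpow_mem_span (r : CoordRing k q) (n : ℤ) :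
    algebraMap (CoordRing k q) (FnField k q) r * y k q ^ n ∈
      Submodule.span k (mono k q '' {p | p.1 ≤ q}) := by
  obtain ⟨p, rfl⟩ := AdjoinRoot.mk_surjective r
  have hmod : AdjoinRoot.mk (poly k q) (p %ₘ poly k q) = AdjoinRoot.mk (poly k q) p := by
    conv_rhs => rw [← modByMonic_add_div p (poly k q)]
    rw [map_add, map_mul, AdjoinRoot.mk_self, zero_mul, add_zero]
  rw [← hmod]
  refine mk_mul_zpow_mem_span ?_ n
  have h := natDegree_modByMonic_lt p (poly_monic k q) (fun h => by
    have := poly_degree k q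
    rw [h, degree_one] at this
    exact absurd this.symm (by exact_mod_cast Nat.succ_ne_zero q))
  rw [natDegree_eq_of_degree_eq_some (poly_degree k q)] at h
  omega

theorem mem_RRSpace_twoPoint {f : FnField k q} (hf : f ≠ 0) {a b : ℤ} :
    f ∈ RRSpace (twoPoint k q a b) ↔ -a ≤ (Pinf k q).ord f ∧ -b ≤ (P0 k q).ord f ∧
      ∀ P, P ≠ Pinf k q → P ≠ P0 k q → 0 ≤ P.ord f := by
  have hne := Pinf_ne_P0 (k := k) (q := q)
  have hG1 : twoPoint k q a b (Pinf k q) = a := by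
    simp [twoPoint, hne.symm]
  have hG2 : twoPoint k q a b (P0 k q) = b := by
    simp [twoPoint, hne]
  have hG3 : ∀ P, P ≠ Pinf k q → P ≠ P0 k q → twoPoint k q a b P = 0 := by
    intro P h1 h2
    simp [twoPoint, h1.symm, h2.symm]
  rw [RRSpace, Set.mem_ofPred_eq, or_iff_right hf]
  constructor
  · intro h
    refine ⟨?_, ?_, fun P h1 h2 => ?_⟩
    · have := h (Pinf k q); omega
    · have := h (P0 k q); omega
    · have := h P
      rwa [hG3 P h1 h2, add_zero] at this
  · rintro ⟨h1, h2, h3⟩ P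
    by_cases hP1 : P = Pinf k q
    · subst hP1; omega
    by_cases hP2 : P = P0 k q
    · subst hP2; omega
    rw [hG3 P hP1 hP2, add_zero]
    exact h3 P hP1 hP2

theorem ne_zero_of_mem_pairsZero {f g : FnField k q} {a b : ℤ} (h : (f, g) ∈ pairsZero k q a b) :
    f ≠ 0 := by
  rintro rfl
  refine h.1.2 (Or.inl ?_)
  exact zero_mul g

theorem ne_zero_of_mem_pairsInf {f g : FnField k q} {a b : ℤ} (h : (f, g) ∈ pairsInf k q a b) :
    f ≠ 0 ∧ g ≠ 0 := by
  constructor <;> rintro rfl <;> refine h.1.2 (Or.inl ?_)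
  · exact zero_mul g
  · exact mul_zero f

variable [IsDedekindDomain (CoordRing k q)]

theorem eq_P0_of_y_mem_nonunits {P : Place k (FnField k q)} (h : y k q ∈ P.ring.nonunits) :
    P = P0 k q := place_eq_of_y_mem_nonunits h y_mem_P0

variable (k q) in
theorem comap_swap_Pinf : (Pinf k q).comap (swap k q) = P0 k q :=
  eq_P0_of_y_mem_nonunits (swap_mem_nonunits k q y_notMem_Pinf).2

variable (k q) in
theorem comap_swap_P0 : (P0 k q).comap (swap k q) = Pinf k q := by
  rw [← comap_swap_Pinf, comap_swap_comap_swap]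

theorem y_mem_of_ne_Pinf {P : Place k (FnField k q)} (h : P ≠ Pinf k q) : y k q ∈ P.ring := by
  by_contra hy
  apply h
  rw [← comap_swap_comap_swap k q P, eq_P0_of_y_mem_nonunits (swap_mem_nonunits k q hy).2,
    comap_swap_P0]

theorem ord_P0_x : (P0 k q).ord (x k q) = 1 := ord_x_of_mem_nonunits y_mem_P0

theorem ord_P0_y : (P0 k q).ord (y k q) = q + 1 := by
  rw [ord_y_of_mem_nonunits y_mem_P0, ord_P0_x, mul_one]

theorem ord_Pinf {f : FnField k q} (hf : f ≠ 0) : (Pinf k q).ord f = (P0 k q).ord (swap k q f) := by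
  rw [← comap_swap_P0, (isDiscrete _).ord_comap _ hf]

theorem ord_Pinf_x : (Pinf k q).ord (x k q) = -q := by
  rw [ord_Pinf (x_ne_zero k q), swap_x, div_eq_mul_inv, ← zpow_neg_one,
    (isDiscrete _).ord_mul (x_ne_zero k q) (zpow_ne_zero _ (y_ne_zero k q)),
    (isDiscrete _).ord_zpow (y_ne_zero k q), ord_P0_x, ord_P0_y]
  ring

theorem ord_Pinf_y : (Pinf k q).ord (y k q) = -(q + 1) := by
  rw [ord_Pinf (y_ne_zero k q), swap_y, ← zpow_neg_one,
    (isDiscrete _).ord_zpow (y_ne_zero k q), ord_P0_y]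
  ring

theorem ord_mono (P : Place k (FnField k q)) (p : ℕ × ℤ) :
    P.ord (mono k q p) = p.1 * P.ord (x k q) + p.2 * P.ord (y k q) := by
  rw [mono, (isDiscrete P).ord_mul (pow_ne_zero _ (x_ne_zero k q))
    (zpow_ne_zero _ (y_ne_zero k q)), (isDiscrete P).ord_pow (x_ne_zero k q),
    (isDiscrete P).ord_zpow (y_ne_zero k q)]

theorem ord_P0_mono (p : ℕ × ℤ) : (P0 k q).ord (mono k q p) = p.1 + p.2 * (q + 1) := by
  rw [ord_mono, ord_P0_x, ord_P0_y, mul_one]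

theorem ord_Pinf_mono (p : ℕ × ℤ) :
    (Pinf k q).ord (mono k q p) = -(p.1 * q + p.2 * (q + 1)) := by
  rw [ord_mono, ord_Pinf_x, ord_Pinf_y]
  ring

/-- Negative powers of `y` are harmless: away from the two points `y` is a unit. -/
theorem ord_mono_nonneg {P : Place k (FnField k q)} (h1 : P ≠ Pinf k q) (h2 : P ≠ P0 k q)
    (p : ℕ × ℤ) : 0 ≤ P.ord (mono k q p) := by
  have hP := isDiscrete P
  have hy := y_mem_of_ne_Pinf h1
  have hx1 := (hP.ord_nonneg_iff (x_ne_zero k q)).2 (x_mem_of_y_mem k q hy)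
  have hy1 := (hP.ord_nonneg_iff (y_ne_zero k q)).2 hy
  have hy2 : P.ord (y k q) = 0 := by
    refine le_antisymm (not_lt.1 fun h => h2 (eq_P0_of_y_mem_nonunits ?_)) hy1
    exact (hP.ord_pos_iff (y_ne_zero k q)).1 h
  rw [ord_mono, hy2, mul_zero, add_zero]
  positivity

theorem injOn_ord_P0_mono :
    Set.InjOn (fun p => (P0 k q).ord (mono k q p)) {p : ℕ × ℤ | p.1 ≤ q} := by
  rintro ⟨s, t⟩ hs ⟨s', t'⟩ hs' h
  simp only [ord_P0_mono, Set.mem_ofPred_eq] at h hs hs'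
  obtain ⟨h1, h2⟩ := eq_of_modEq (by positivity) (by positivity) (by omega) (by omega) h
  exact Prod.ext (by exact_mod_cast h1) h2

theorem injOn_ord_Pinf_mono :
    Set.InjOn (fun p => (Pinf k q).ord (mono k q p)) {p : ℕ × ℤ | p.1 ≤ q} := by
  rintro ⟨s, t⟩ hs ⟨s', t'⟩ hs' h
  simp only [ord_Pinf_mono, Set.mem_ofPred_eq, neg_inj] at h hs hs'
  -- Since `s q + t (q + 1) + q = (q - s) + (s + t) (q + 1)`, the remainder modulo `q + 1` is `q -
  -- s`.
  obtain ⟨h1, h2⟩ := eq_of_modEq (s := q - s) (s' := q - s') (t := s + t) (t' := s' + t')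
    (n := q + 1) (by omega) (by omega) (by omega) (by omega) (by linear_combination h)
  refine Prod.ext ?_ ?_ <;> simp only <;> omega

/-- A function that is regular outside `P_∞` and `P_0` is a linear combination of monomials. -/
theorem mem_span_mono {f : FnField k q} (hf : f ≠ 0)
    (h : ∀ P, P ≠ Pinf k q → P ≠ P0 k q → 0 ≤ P.ord f) :
    f ∈ Submodule.span k (mono k q '' {p | p.1 ≤ q}) := by
  -- Multiplying by `y ^ N` clears the pole at `P_0`; the product is then integral at every prime,
  -- so it lies in the coordinate ring.
  set N : ℕ := (-(P0 k q).ord f).toNat with hN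
  have hyN : y k q ^ N ≠ 0 := pow_ne_zero _ (y_ne_zero k q)
  obtain ⟨r, hr⟩ := HeightOneSpectrum.mem_integers_of_valuation_le_one (R := CoordRing k q)
      (FnField k q) (f * y k q ^ N) (fun v => by
    have hmem : ∀ r : CoordRing k q, algebraMap (CoordRing k q) (FnField k q) r ∈
        (v.valuation (FnField k q)).valuationSubring := fun r => v.valuation_le_one r
    let P : Place k (FnField k q) := ⟨(v.valuation (FnField k q)).valuationSubring, fun c => by
      rw [IsScalarTower.algebraMap_apply k (CoordRing k q)]
      exact hmem _, fun htop => by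
      obtain ⟨t, ht⟩ := v.valuation_exists_uniformizer (FnField k q)
      have h1 : t⁻¹ ∈ (v.valuation (FnField k q)).valuationSubring :=
        htop ▸ ValuationSubring.mem_top _
      rw [Valuation.mem_valuationSubring_iff, map_inv₀, ht, ← exp_neg, ← exp_zero, exp_le_exp] at h1
      omega⟩
    have hP := isDiscrete P
    have hy : y k q ∈ P.ring := hmem _
    have hPinf : P ≠ Pinf k q := fun h => y_notMem_Pinf (h ▸ hy)
    refine (hP.ord_nonneg_iff (mul_ne_zero hf hyN)).1 ?_
    rw [hP.ord_mul hf hyN, hP.ord_pow (y_ne_zero k q)]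
    by_cases h0 : P = P0 k q
    · rw [h0, ord_P0_y]
      have h1 : -(P0 k q).ord f ≤ N := Int.self_le_toNat _
      nlinarith
    · have h1 := (hP.ord_nonneg_iff (y_ne_zero k q)).2 hy
      have h2 := h P hPinf h0
      positivity)
  have h1 := algebraMap_mul_zpow_mem_span r (-N)
  rwa [hr, zpow_neg, zpow_natCast, mul_inv_cancel_right₀ hyN] at h1

/-- Take the term of `f` that dominates at `P_∞`. At `P_0` distinct orders again exclude
cancellation, so no term has smaller order there than `f`. -/
theorem exists_mono_of_regular {f : FnField k q} (hf : f ≠ 0)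
    (h : ∀ P, P ≠ Pinf k q → P ≠ P0 k q → 0 ≤ P.ord f) :
    ∃ p : ℕ × ℤ, p.1 ≤ q ∧ (Pinf k q).ord f = -(p.1 * q + p.2 * (q + 1)) ∧
      (P0 k q).ord f ≤ p.1 + p.2 * (q + 1) := by
  obtain ⟨l, hl, rfl⟩ := (Finsupp.mem_span_image_iff_linearCombination k).1 (mem_span_mono hf h)
  have hlq : ∀ p ∈ l.support, p.1 ≤ q := fun p hp => hl hp
  rw [Finsupp.linearCombination_apply, Finsupp.sum] at hf ⊢
  have hT : l.support.Nonempty := by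
    rw [Finset.nonempty_iff_ne_empty]
    intro he
    rw [he, Finset.sum_empty] at hf
    exact hf rfl
  have hne : ∀ p ∈ l.support, l p • mono k q p ≠ 0 := fun p hp =>
    smul_ne_zero (Finsupp.mem_support_iff.1 hp) (mono_ne_zero p)
  have hord : ∀ P : Place k (FnField k q), ∀ p ∈ l.support,
      P.ord (l p • mono k q p) = P.ord (mono k q p) := by
    intro P p hp
    have hc := Finsupp.mem_support_iff.1 hp
    rw [Algebra.smul_def, (isDiscrete P).ord_mul (by simpa using hc) (mono_ne_zero p),
      (isDiscrete P).ord_algebraMap hc, zero_add]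
  have hinj : ∀ P : Place k (FnField k q), Set.InjOn (fun p => P.ord (mono k q p)) {p | p.1 ≤ q} →
      Set.InjOn (fun p => P.ord (l p • mono k q p)) l.support := by
    intro P hP a ha b hb hab
    simp only [hord P a ha, hord P b hb] at hab
    exact hP (hlq a ha) (hlq b hb) hab
  obtain ⟨p, hp, hp1, -⟩ := (isDiscrete (Pinf k q)).exists_ord_sum_eq hT hne
    (hinj _ injOn_ord_Pinf_mono)
  obtain ⟨p', hp', hp1', hp2'⟩ := (isDiscrete (P0 k q)).exists_ord_sum_eq hT hne
    (hinj _ injOn_ord_P0_mono)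
  refine ⟨p, hlq p hp, ?_, ?_⟩
  · rw [hp1, hord _ p hp, ord_Pinf_mono]
  · rw [hp1', ← ord_P0_mono (k := k), ← hord _ p hp]
    exact hp2' p hp

/-- The involution exchanges the two points and permutes the remaining places. -/
theorem swap_mem_RRSpace {f : FnField k q} {a b : ℤ} :
    swap k q f ∈ RRSpace (twoPoint k q a b) ↔ f ∈ RRSpace (twoPoint k q b a) := by
  by_cases hf : f = 0
  · subst hf
    rw [map_zero]
    exact iff_of_true (Or.inl rfl) (Or.inl rfl)
  have hf' : swap k q f ≠ 0 := by simpa using hf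
  have hinj : ∀ P Q : Place k (FnField k q), P.comap (swap k q) = Q → P = Q.comap (swap k q) := by
    rintro P _ rfl
    rw [comap_swap_comap_swap]
  rw [mem_RRSpace_twoPoint hf', mem_RRSpace_twoPoint hf, ← ord_Pinf hf, ord_Pinf hf', swap_swap,
    and_left_comm]
  refine and_congr_right fun _ => and_congr_right fun _ => ⟨fun h P h1 h2 => ?_, fun h P h1 h2 => ?_⟩
  · have h3 := h (P.comap (swap k q)) (fun h3 => h2 (by rw [hinj _ _ h3, comap_swap_Pinf]))
      (fun h3 => h1 (by rw [hinj _ _ h3, comap_swap_P0]))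
    rwa [(isDiscrete P).ord_comap _ hf', swap_swap] at h3
  · have h3 := h (P.comap (swap k q)) (fun h3 => h2 (by rw [hinj _ _ h3, comap_swap_Pinf]))
      (fun h3 => h1 (by rw [hinj _ _ h3, comap_swap_P0]))
    rwa [(isDiscrete P).ord_comap _ hf] at h3

theorem swap_mem_pairsInf {f g : FnField k q} {a b : ℤ} :
    (swap k q f, swap k q g) ∈ pairsInf k q b a ↔ (f, g) ∈ pairsZero k q a b := by
  simp only [pairsInf, pairsZero, Set.mem_ofPred_eq, Set.mem_sdiff, ← map_mul, swap_mem_RRSpace,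
    add_comm b a]

theorem multZero_eq_multInf (a b : ℤ) : multZero k q a b = multInf k q b a := by
  rw [multZero, multInf]
  congr 1
  ext i
  simp only [Set.mem_ofPred_eq]
  refine and_congr_right fun _ => and_congr_right fun _ => ⟨?_, ?_⟩
  · rintro ⟨f, g, h, hi⟩
    have hf := ne_zero_of_mem_pairsZero h
    refine ⟨swap k q f, swap k q g, swap_mem_pairsInf.2 h, ?_⟩
    rw [ord_Pinf (by simpa using hf), swap_swap, hi]
  · rintro ⟨f, g, h, hi⟩
    refine ⟨swap k q f, swap k q g, ?_, ?_⟩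
    · rwa [← swap_mem_pairsInf, swap_swap, swap_swap]
    · rw [← ord_Pinf (ne_zero_of_mem_pairsInf h).1, hi]

/-- Replace `f` and `g` by their dominant monomials at `P_∞`; conversely, monomials with such
exponents form an admissible pair. The bounds on `i` are automatic: `i ≥ s + t (q + 1) ≥ -b`, and `a
+ 1 - i` is a nonnegative combination of `q` and `q + 1`. -/
theorem multInf_set_eq (a b : ℤ) :
    {i : ℤ | -b ≤ i ∧ i ≤ a + 1 ∧
      ∃ f g, (f, g) ∈ pairsInf k q (a + 1) b ∧ (Pinf k q).ord f = -i} =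
    {i : ℤ | ∃ p p' : ℕ × ℤ, p.1 ≤ q ∧ p'.1 ≤ q ∧ i = p.1 * q + p.2 * (q + 1) ∧
      -b ≤ p.1 + p.2 * (q + 1) ∧ 0 ≤ p'.2 ∧ a + 1 - i = p'.1 * q + p'.2 * (q + 1)} := by
  ext i
  constructor
  · rintro ⟨-, -, f, g, h, hi⟩
    obtain ⟨hf, hg⟩ := ne_zero_of_mem_pairsInf h
    obtain ⟨⟨h1, h2⟩, h3, h4⟩ := h
    change f * g ∈ _ at h1
    change f * g ∉ _ at h2
    change f ∈ _ at h3
    change g ∈ _ at h4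
    rw [mem_RRSpace_twoPoint (mul_ne_zero hf hg)] at h1 h2
    rw [mem_RRSpace_twoPoint hf] at h3
    rw [mem_RRSpace_twoPoint hg] at h4
    -- The two spaces differ only in the condition at `P_∞`, so the order of `f * g` there is
    -- exactly `-(a + 1)`.
    have h5 : ¬ -(a + 1 - 1) ≤ (Pinf k q).ord (f * g) := fun h => h2 ⟨h, h1.2⟩
    have h6 := h1.1
    rw [(isDiscrete _).ord_mul hf hg] at h5 h6
    obtain ⟨p, hp1, hp2, hp3⟩ := exists_mono_of_regular hf h3.2.2
    obtain ⟨p', hp1', hp2', hp3'⟩ := exists_mono_of_regular hg h4.2.2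
    refine ⟨p, p', hp1, hp1', by linarith, by linarith, ?_, by omega⟩
    -- As `g` is regular at `P_0`, `s' + t' (q + 1) ≥ 0`; with `s' ≤ q` this forces `t' ≥ 0`.
    have h7 : (p'.1 : ℤ) ≤ q := by exact_mod_cast hp1'
    have h8 := h4.2.1
    by_contra hlt
    nlinarith
  · rintro ⟨p, p', hp, hp', hi, hb, hp0, hi'⟩
    have hp0' : (0 : ℤ) ≤ p'.2 * (q + 1) := by positivity
    have hpq : (0 : ℤ) ≤ p'.1 * q := by positivity
    have hq1 : (1 : ℤ) ≤ q := by exact_mod_cast hq.out.one_lt.le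
    have hpp : (0 : ℤ) ≤ p.1 := by positivity
    have hbi : -b ≤ i := by nlinarith
    have hm := mono_ne_zero (k := k) (q := q) p
    have hm' := mono_ne_zero (k := k) (q := q) p'
    have hreg : ∀ P, P ≠ Pinf k q → P ≠ P0 k q → 0 ≤ P.ord (mono k q p * mono k q p') := by
      intro P h1 h2
      rw [(isDiscrete P).ord_mul hm hm']
      exact add_nonneg (ord_mono_nonneg h1 h2 p) (ord_mono_nonneg h1 h2 p')
    refine ⟨hbi, by linarith, mono k q p, mono k q p', ⟨⟨?_, ?_⟩, ?_, ?_⟩, ?_⟩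
    · refine (mem_RRSpace_twoPoint (mul_ne_zero hm hm')).2 ⟨?_, ?_, hreg⟩
      · rw [(isDiscrete _).ord_mul hm hm', ord_Pinf_mono, ord_Pinf_mono]
        linarith
      · rw [(isDiscrete _).ord_mul hm hm', ord_P0_mono, ord_P0_mono]
        have : (0 : ℤ) ≤ p'.1 := by positivity
        linarith
    · intro h
      have h1 := ((mem_RRSpace_twoPoint (mul_ne_zero hm hm')).1 h).1
      rw [(isDiscrete _).ord_mul hm hm', ord_Pinf_mono, ord_Pinf_mono] at h1
      linarith
    · refine (mem_RRSpace_twoPoint hm).2 ⟨?_, ?_, fun P h1 h2 => ord_mono_nonneg h1 h2 p⟩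
      · rw [ord_Pinf_mono]
        linarith
      · rwa [ord_P0_mono]
    · refine (mem_RRSpace_twoPoint hm').2 ⟨?_, ?_, fun P h1 h2 => ord_mono_nonneg h1 h2 p'⟩
      · rw [ord_Pinf_mono]
        linarith
      · rw [ord_P0_mono]
        positivity
    · rw [ord_Pinf_mono, hi]

end

/-! ### Counting exponents -/

theorem card_sigma_toNat (q : ℕ) (f g : ℕ → ℤ) :
    (((Finset.range (q + 1)).sigma fun s => Finset.Icc (f s) (g s)).card : ℤ) =
      ∑ s ∈ Finset.range (q + 1), max 0 (g s + 1 - f s) := by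
  rw [Finset.card_sigma]
  push_cast
  refine Finset.sum_congr rfl fun s _ => ?_
  rw [Int.card_Icc, Int.toNat_eq_max, max_comm]

theorem sum_range_indicator {n : ℕ} {c : ℤ} (h0 : 0 ≤ c) (hn : c ≤ n) :
    ∑ s ∈ Finset.range n, (if (s : ℤ) < c then (1 : ℤ) else 0) = c := by
  lift c to ℕ using h0
  have h : (Finset.range n).filter (fun s : ℕ => (s : ℤ) < c) = Finset.range c := by
    ext s
    simp only [Finset.mem_filter, Finset.mem_range]
    omega
  rw [Finset.sum_ite, h]
  simp

/-- The number of pole numbers `i` at `P_∞` of functions in `L(∞ P_∞ + b P_0)` for which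
`c - i` is a pole number of functions that are regular outside `P_∞`. -/
theorem ncard_poleNumbers (q : ℕ) {a₀ a₁ b₀ b₁ b c : ℤ} (ha₁ : 0 ≤ a₁ ∧ a₁ ≤ q)
    (hb : b = b₀ * (q + 1) - b₁) (hb₁ : 0 ≤ b₁ ∧ b₁ ≤ q)
    (hc : c = (q - 2 + a₀) * (q + 1) - a₁ + 1) :
    ({i : ℤ | ∃ p p' : ℕ × ℤ, p.1 ≤ q ∧ p'.1 ≤ q ∧ i = p.1 * q + p.2 * (q + 1) ∧
      -b ≤ p.1 + p.2 * (q + 1) ∧ 0 ≤ p'.2 ∧ c - i = p'.1 * q + p'.2 * (q + 1)}.ncard : ℤ) =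
    ∑ s ∈ Finset.range (q + 1), max 0 ((if (s : ℤ) < a₁ then q + a₀ + b₀ - a₁ else a₀ + b₀ - a₁) -
      (if (s : ℤ) < b₁ then 1 else 0)) := by
  -- For fixed `s`, `lo s` is the least `t` allowed at `P_0`, and `hi s` the largest `t` whose
  -- complement `c - i` has a representation with `t' ≥ 0`.
  set lo : ℕ → ℤ := fun s => -b₀ + (if (s : ℤ) < b₁ then 1 else 0) with hlo
  set hi : ℕ → ℤ := fun s => if (s : ℤ) < a₁ then q - 1 + a₀ - a₁ else a₀ - 1 - a₁ with hhi
  have hloiff : ∀ s : ℕ, s ≤ q → ∀ t : ℤ, -b ≤ s + t * (q + 1) ↔ lo s ≤ t := by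
    intro s hs t
    have hs' : (s : ℤ) ≤ q := by exact_mod_cast hs
    have hs0 : (0 : ℤ) ≤ s := by positivity
    have he : -b ≤ s + t * (q + 1) ↔ b₁ - s ≤ (t + b₀) * (q + 1) := by
      rw [hb]
      constructor <;> intro h <;> linarith
    rw [he]
    simp only [hlo]
    split_ifs with h
    · constructor
      · intro h1
        by_contra h2
        have h3 : t + b₀ ≤ 0 := by omega
        nlinarith
      · intro h1
        have h3 : 1 ≤ t + b₀ := by omega
        nlinarith
    · constructor
      · intro h1
        by_contra h2
        have h3 : t + b₀ ≤ -1 := by omega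
        nlinarith
      · intro h1
        have h3 : 0 ≤ t + b₀ := by omega
        nlinarith
  have hhi1 : ∀ s s' : ℕ, s ≤ q → s' ≤ q → ∀ t t' : ℤ, 0 ≤ t' →
      c - (s * q + t * (q + 1)) = s' * q + t' * (q + 1) → t ≤ hi s := by
    intro s s' hs hs' t t' ht' h
    -- Modulo `q + 1` the exponent `s'` is determined by `s`. The ranges of `s`, `s'` and `a₁` leave
    -- only `w = 0` when `s < a₁` and `w = 1` otherwise.
    have hw : (s : ℤ) + s' + 1 - a₁ = (s' + t' - q + 2 - a₀ + s + t) * (q + 1) := by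
      rw [hc] at h
      linear_combination h
    set w : ℤ := s' + t' - q + 2 - a₀ + s + t with hwdef
    have hs1 : (s : ℤ) ≤ q := by exact_mod_cast hs
    have hs1' : (s' : ℤ) ≤ q := by exact_mod_cast hs'
    have hs0 : (0 : ℤ) ≤ s := by positivity
    have hs0' : (0 : ℤ) ≤ s' := by positivity
    simp only [hhi]
    split_ifs with hsa
    · have h1 : w < 1 := by
        by_contra h2
        have : 1 ≤ w := by omega
        nlinarith
      have h2 : -1 < w := by
        by_contra h2
        have : w ≤ -1 := by omega
        nlinarith
      have h3 : w = 0 := by omega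
      rw [h3, zero_mul] at hw
      omega
    · have h1 : w < 2 := by
        by_contra h2
        have : 2 ≤ w := by omega
        nlinarith
      have h2 : 0 < w := by
        by_contra h2
        have : w ≤ 0 := by omega
        nlinarith
      have h3 : w = 1 := by omega
      rw [h3, one_mul] at hw
      omega
  have hhi2 : ∀ s : ℕ, s ≤ q → ∀ t : ℤ, t ≤ hi s → ∃ p' : ℕ × ℤ, p'.1 ≤ q ∧ 0 ≤ p'.2 ∧
      c - (s * q + t * (q + 1)) = p'.1 * q + p'.2 * (q + 1) := by
    intro s hs t ht
    simp only [hhi] at ht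
    split_ifs at ht with hsa
    -- The forced complement: `s'` solves `w = 0` here and `w = 1` in the other branch, and `t' = hi
    -- s - t`.
    · refine ⟨((a₁ - 1 - s).toNat, q - 1 + a₀ - a₁ - t), by simp only; omega, by simp only; omega, ?_⟩
      have h1 : ((a₁ - 1 - s).toNat : ℤ) = a₁ - 1 - s := Int.toNat_of_nonneg (by omega)
      simp only [h1, hc]
      ring
    · refine ⟨((a₁ + q - s).toNat, a₀ - 1 - a₁ - t), by simp only; omega, by simp only; omega, ?_⟩
      have h1 : ((a₁ + q - s).toNat : ℤ) = a₁ + q - s := Int.toNat_of_nonneg (by omega)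
      simp only [h1, hc]
      ring
  have hset : {i : ℤ | ∃ p p' : ℕ × ℤ, p.1 ≤ q ∧ p'.1 ≤ q ∧ i = p.1 * q + p.2 * (q + 1) ∧
      -b ≤ p.1 + p.2 * (q + 1) ∧ 0 ≤ p'.2 ∧ c - i = p'.1 * q + p'.2 * (q + 1)} =
      (fun p : (_ : ℕ) × ℤ => (p.1 * q + p.2 * (q + 1) : ℤ)) ''
        ((Finset.range (q + 1)).sigma fun s => Finset.Icc (lo s) (hi s) : Finset _) := by
    ext i
    simp only [Set.mem_ofPred_eq, Set.mem_image, Finset.mem_coe, Finset.mem_sigma,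
      Finset.mem_range_succ_iff, Finset.mem_Icc]
    constructor
    · rintro ⟨⟨s, t⟩, ⟨s', t'⟩, hs, hs', rfl, h1, h2, h3⟩
      exact ⟨⟨s, t⟩, ⟨hs, (hloiff s hs t).1 h1, hhi1 s s' hs hs' t t' h2 h3⟩, rfl⟩
    · rintro ⟨⟨s, t⟩, ⟨hs, h1, h2⟩, rfl⟩
      obtain ⟨p', h3, h4, h5⟩ := hhi2 s hs t h2
      exact ⟨(s, t), p', hs, h3, rfl, (hloiff s hs t).2 h1, h4, h5⟩
  rw [hset, Set.InjOn.ncard_image, Set.ncard_coe_finset, card_sigma_toNat]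
  · refine Finset.sum_congr rfl fun s _ => ?_
    congr 1
    simp only [hlo, hhi]
    split_ifs <;> ring
  · rintro ⟨s, t⟩ hs ⟨s', t'⟩ hs' h
    simp only [Finset.coe_sigma, Set.mem_sigma_iff, Finset.mem_coe, Finset.mem_range] at hs hs' h
    obtain ⟨h1, h2⟩ := eq_of_modEq (s := q - s) (s' := q - s') (t := s + t) (t' := s' + t')
      (n := q + 1) (by omega) (by omega) (by omega) (by omega) (by linear_combination h)
    obtain rfl : s = s' := by omega
    obtain rfl : t = t' := by omega
    rfl

theorem two_mul_genus (q : ℕ) : (2 * genus q : ℤ) = q * (q - 1) := by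
  have h : 2 * (q * (q - 1) / 2) = q * (q - 1) := Nat.mul_div_cancel' (Nat.even_mul_pred_self q).two_dvd
  rcases q with _ | q
  · simp [genus]
  · rw [genus]
    have h' := congrArg (Nat.cast : ℕ → ℤ) h
    push_cast at h' ⊢
    rw [h']
    simp

/-! ### Evaluating the sum in the three cases -/

section

variable (k : Type*) [Field k] (q : ℕ) [hq : Fact (IsPrimePow q)] [IsDedekindDomain (CoordRing k q)]
  {a b a₀ a₁ b₀ b₁ : ℤ}

theorem multInf_eq_sum (ha : a = a₀ * (q + 1) - a₁) (ha₁ : 0 ≤ a₁ ∧ a₁ ≤ q)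
    (hb : b = b₀ * (q + 1) - b₁) (hb₁ : 0 ≤ b₁ ∧ b₁ ≤ q) :
    (multInf k q (2 * genus q - 2 + a) b : ℤ) =
    ∑ s ∈ Finset.range (q + 1), max 0 ((if (s : ℤ) < a₁ then q + a₀ + b₀ - a₁ else a₀ + b₀ - a₁) -
      (if (s : ℤ) < b₁ then 1 else 0)) := by
  rw [multInf, multInf_set_eq]
  refine ncard_poleNumbers q ha₁ hb hb₁ ?_
  rw [two_mul_genus, ha]
  ring

/-- Here `a₀ + b₀ - a₁ ≥ 1` absorbs the subtracted indicator, so no summand is truncated. -/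
theorem multInf_of_lt (ha : a = a₀ * (q + 1) - a₁) (ha₁ : 0 ≤ a₁ ∧ a₁ ≤ q)
    (hb : b = b₀ * (q + 1) - b₁) (hb₁ : 0 ≤ b₁ ∧ b₁ ≤ q) (h : a₁ < a₀ + b₀) :
    (multInf k q (2 * genus q - 2 + a) b : ℤ) = a + b := by
  have hterm : ∀ s ∈ Finset.range (q + 1),
      max 0 ((if (s : ℤ) < a₁ then q + a₀ + b₀ - a₁ else a₀ + b₀ - a₁) -
        (if (s : ℤ) < b₁ then 1 else 0)) = (a₀ + b₀ - a₁) + q * (if (s : ℤ) < a₁ then 1 else 0) -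
        (if (s : ℤ) < b₁ then 1 else 0) := by
    intro s _
    split_ifs <;> rw [max_eq_right (by omega)] <;> ring
  rw [multInf_eq_sum k q ha ha₁ hb hb₁, Finset.sum_congr rfl hterm, Finset.sum_sub_distrib,
    Finset.sum_add_distrib, ← Finset.mul_sum, sum_range_indicator ha₁.1 (by push_cast; omega),
    sum_range_indicator hb₁.1 (by push_cast; omega), Finset.sum_const, Finset.card_range,
    nsmul_eq_mul, ha, hb]
  push_cast
  ring

/-- Exactly the summands with `s ≥ a₁` are truncated, so the total is `a₁ (q + a₀ + b₀ - a₁) - min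
a₁ b₁`. -/
theorem multInf_of_le (ha : a = a₀ * (q + 1) - a₁) (ha₁ : 0 ≤ a₁ ∧ a₁ ≤ q)
    (hb : b = b₀ * (q + 1) - b₁) (hb₁ : 0 ≤ b₁ ∧ b₁ ≤ q) (h : a₀ + b₀ ≤ a₁)
    (h' : a₁ ≤ a₀ + b₀ + q - 1) :
    (multInf k q (2 * genus q - 2 + a) b : ℤ) =
      a + b + (a₁ - a₀ - b₀) * (q + 1 - a₁) + max 0 (b₁ - a₁) := by
  have hterm : ∀ s ∈ Finset.range (q + 1),
      max 0 ((if (s : ℤ) < a₁ then q + a₀ + b₀ - a₁ else a₀ + b₀ - a₁) -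
        (if (s : ℤ) < b₁ then 1 else 0)) =
      (q + a₀ + b₀ - a₁) * (if (s : ℤ) < a₁ then 1 else 0) -
        (if (s : ℤ) < min a₁ b₁ then 1 else 0) := by
    intro s _
    simp only [lt_min_iff]
    by_cases h1 : (s : ℤ) < a₁ <;> by_cases h2 : (s : ℤ) < b₁ <;>
      simp only [h1, h2, if_true, if_false, and_true, and_false]
    · rw [max_eq_right (by omega)]; ring
    · rw [max_eq_right (by omega)]; ring
    · rw [max_eq_left (by omega)]; ring
    · rw [max_eq_left (by omega)]; ring
  have hmin : max 0 (b₁ - a₁) = b₁ - min a₁ b₁ := by omega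
  rw [multInf_eq_sum k q ha ha₁ hb hb₁, Finset.sum_congr rfl hterm, Finset.sum_sub_distrib,
    ← Finset.mul_sum, sum_range_indicator ha₁.1 (by push_cast; omega),
    sum_range_indicator (by omega) (by push_cast; omega), hmin, ha, hb]
  ring

theorem multInf_of_gt (ha : a = a₀ * (q + 1) - a₁) (ha₁ : 0 ≤ a₁ ∧ a₁ ≤ q)
    (hb : b = b₀ * (q + 1) - b₁) (hb₁ : 0 ≤ b₁ ∧ b₁ ≤ q) (h : a₀ + b₀ + q - 1 < a₁) :
    multInf k q (2 * genus q - 2 + a) b = 0 := by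
  have h1 := multInf_eq_sum k q ha ha₁ hb hb₁
  rw [Finset.sum_eq_zero] at h1
  · exact_mod_cast h1
  · intro s _
    split_ifs <;> exact max_eq_left (by omega)

/-- The twist by `(q - 2) (q + 1) = 2 g - 2` moves between the two points. -/
theorem multZero_eq_multInf_add :
    multZero k q (2 * genus q - 2 + a) b =
      multInf k q (2 * genus q - 2 + (b - (q - 2) * (q + 1))) (a + (q - 2) * (q + 1)) := by
  rw [multZero_eq_multInf]
  have h := two_mul_genus q
  congr 1 <;> rw [h] <;> ring

end

end Hermitian

end

theorem theorem3p2 (q : ℕ) [Fact (IsPrimePow q)] (k : Type*) [Field k]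
    (hk : Nat.card k = q ^ 2) (a b a₀ a₁ b₀ b₁ d : ℤ)
    (ha : a = a₀ * (q + 1) - a₁) (ha₁ : 0 ≤ a₁ ∧ a₁ ≤ q)
    (hb : b = b₀ * (q + 1) - b₁) (hb₁ : 0 ≤ b₁ ∧ b₁ ≤ q)
    (hd : d = a + b) :
    (a₁ < a₀ + b₀ →
      (Hermitian.multInf k q (2 * Hermitian.genus q - 2 + a) b : ℤ) = d) ∧
    (a₀ + b₀ ≤ a₁ ∧ a₁ ≤ a₀ + b₀ + q - 1 →
      (Hermitian.multInf k q (2 * Hermitian.genus q - 2 + a) b : ℤ) =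
        d + (a₁ - a₀ - b₀) * (q + 1 - a₁) + max 0 (b₁ - a₁)) ∧
    (a₀ + b₀ + q - 1 < a₁ →
      Hermitian.multInf k q (2 * Hermitian.genus q - 2 + a) b = 0) ∧
    (b₁ < a₀ + b₀ →
      (Hermitian.multZero k q (2 * Hermitian.genus q - 2 + a) b : ℤ) = d) ∧
    (a₀ + b₀ ≤ b₁ ∧ b₁ ≤ a₀ + b₀ + q - 1 →
      (Hermitian.multZero k q (2 * Hermitian.genus q - 2 + a) b : ℤ) =
        d + (b₁ - a₀ - b₀) * (q + 1 - b₁) + max 0 (a₁ - b₁)) ∧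
    (a₀ + b₀ + q - 1 < b₁ →
      Hermitian.multZero k q (2 * Hermitian.genus q - 2 + a) b = 0) := by
  have := Hermitian.isDedekindDomain_coordRing k q hk
  -- The twist changes neither `a₀ + b₀` nor the remainders, so the cases at `P_0` are those at
  -- `P_∞` with `a₁` and `b₁` exchanged.
  have ha' : a + (q - 2) * (q + 1) = (a₀ + (q - 2)) * (q + 1) - a₁ := by rw [ha]; ring
  have hb' : b - (q - 2) * (q + 1) = (b₀ - (q - 2)) * (q + 1) - b₁ := by rw [hb]; ring
  rw [Hermitian.multZero_eq_multInf_add]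
  refine ⟨fun h => ?_, fun h => ?_, fun h => ?_, fun h => ?_, fun h => ?_, fun h => ?_⟩
  · rw [Hermitian.multInf_of_lt k q ha ha₁ hb hb₁ h, hd]
  · rw [Hermitian.multInf_of_le k q ha ha₁ hb hb₁ h.1 h.2, hd]
  · exact Hermitian.multInf_of_gt k q ha ha₁ hb hb₁ h
  · rw [Hermitian.multInf_of_lt k q hb' hb₁ ha' ha₁ (by linarith), hd]
    ring
  · rw [Hermitian.multInf_of_le k q hb' hb₁ ha' ha₁ (by linarith) (by linarith), hd]
    ring
  · exact Hermitian.multInf_of_gt k q hb' hb₁ ha' ha₁ (by linarith)
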